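/- Let $M$ be a loopless matroid on a finite ground set $E$, with set of flats $\mathcal L(M)$, of rank $d+1$ with $d\ge 2$. For flats $F\subseteq G$ let $M_F^G$ be the matroid on $G\setminus F$ whose flats are the sets $H\setminus F$ with $H\in\mathcal L(M)$, $F\subseteq H\subseteq G$; identify such a flat with $H$. Write $M^G=M_\varnothing^G$, $M_F=M_F^E$. Let $N=M_F^G$, and let $\mathcal P(N)$ be the set of flats $H$ of $M$ with $F\subsetneq H\subsetneq G$. In $\mathbb R^{\mathcal P(N)}$, with standard basis $(\delta_H)$, put $\alpha_i=\sum_{H\ni i}\delta_H$ and $\beta_i=\sum_{H\not\ni i}\delta_H$ for $i\in G\setminus F$, and let $L_N=\mathbb R^{\mathcal P(N)}/\operatorname{span}\{\alpha_i-\alpha_j : i,j\in G\setminus F\}$. The images $\alpha,\beta\in L_N$ of $\alpha_i,\beta_i$ do not depend on $i$. For $H\in\mathcal P(N)$ define linear maps $\pi^H:\mathbb R^{\mathcal P(N)}\to L_{M_F^H}$ and $\pi_H:\mathbb R^{\mathcal P(N)}\to L_{M_H^G}$ by $$\pi^H(\delta_K)=\begin{cases}\delta_K&K\subsetneq H\\-\alpha&K=H\\0&\text{else,}\end{cases}\qquad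 \pi_H(\delta_K)=\begin{cases}\delta_K&K\supsetneq H\\-\beta&K=H\\0&\text{else.}\end{cases}$$ The volume polynomials $V_N:L_N\to\mathbb R$ of the minors $N=M_F^G$ are the functions characterized by: $V_N=1$ if $N$ has rank $1$; $V_N(0)=0$ if the rank of $N$ is not $1$; and, for all $H\in\mathcal P(N)$ and $t\in\mathbb R^{\mathcal P(N)}$, the derivative of $V_N$ at the class of $t$ in the direction of the class of $\delta_H$ is $V_{M_F^H}(\pi^H(t))\,V_{M_H^G}(\pi_H(t))$. The function $V_M=V_{M_\varnothing^E}$ is a homogeneous polynomial of degree $d$ on $L_M=L_{M_\varnothing^E}$. A function $c:2^E\to\mathbb R$ is strictly submodular if $c(\varnothing)=c(E)=0$ and $c(I)+c(J)>c(I\cap J)+c(I\cup J)$ for all incomparable $\varnothing\subsetneq I,J\subsetneq E$. The ample cone $\mathcal K_M\subseteq L_M$ is the set of classes of the vectors $\sum_{H\in\mathcal P(M)}c(H)\delta_H$ with $c$ strictly submodular. For $x\in L_M$ let $D_x$ denote the directional derivative along $x$ of functions on $L_M$. **Theorem.** Let $u_1,\dots,u_{d-2}\in\mathcal K_M$ and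 $x,y\in L_M$ with $D_x^2D_{u_1}\cdots D_{u_{d-2}}V_M>0$. Then $$(D_x^2D_{u_1}\cdots D_{u_{d-2}}V_M)\,(D_y^2D_{u_1}\cdots D_{u_{d-2}}V_M)\le (D_xD_yD_{u_1}\cdots D_{u_{d-2}}V_M)^2 .$$ (These derivatives of $V_M$ of order $d$ are constants.) -/

import Mathlib

/-
Matroids are Mathlib's `Matroid`.  For flats `F ⊆ G` of `M`, the minor `M_F^G` is the matroid on the
ground set `G \ F` whose flats are the sets `H \ F`, for `H` a flat of `M` with `F ⊆ H ⊆ G`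
(see `isFlat_minor_iff`).  As usual, the flat `H \ F` of `M_F^G` is identified with the flat `H` of
`M`.  Everything below is defined for all the minors `M_F^G`, always named by the pair `(F, G)`;
`M^G` is `(∅, G)`, `M_F` is `(F, M.E)`, and a loopless matroid `M` itself is `(∅, M.E)`.
-/

namespace MatroidVolume

open Matroid

variable {α : Type*}

/-- The flats of `M_F^G`, up to removing `F`, are the flats of `M` between `F` and `G`. -/
theorem isFlat_minor_iff (M : Matroid α) {F G : Set α} (hG : M.IsFlat G)
    (hFG : F ⊆ G) (X : Set α) :
    ((M ↾ G) ／ F).IsFlat X ↔ ∃ H, M.IsFlat H ∧ F ⊆ H ∧ H ⊆ G ∧ X = H \ F := by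
  have key : ∀ Y : Set α, Y ⊆ G → ((M ↾ G) ／ F).closure Y = M.closure (Y ∪ F) \ F := by
    intro Y hY
    have hYF : Y ∪ F ⊆ G := Set.union_subset hY hFG
    have h1 : M.closure (Y ∪ F) ⊆ G := by
      have := M.closure_subset_closure hYF
      rwa [hG.closure] at this
    rw [contract_closure_eq, restrict_closure_eq M hYF hG.subset_ground,
      Set.inter_eq_left.2 h1]
  constructor
  · intro hX
    have hXE : X ⊆ G \ F := by simpa using hX.subset_ground
    have hXG : X ⊆ G := hXE.trans Set.sdiff_subset
    have hXF : X ∪ F ⊆ G := Set.union_subset hXG hFG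
    refine ⟨M.closure (X ∪ F), isFlat_closure _, ?_, ?_, ?_⟩
    · exact Set.subset_union_right.trans
        (M.subset_closure (X ∪ F) (hXF.trans hG.subset_ground))
    · have := M.closure_subset_closure hXF
      rwa [hG.closure] at this
    · rw [← key X hXG, hX.closure]
  · rintro ⟨H, hH, hFH, hHG, rfl⟩
    rw [isFlat_iff_closure_eq, key _ (Set.sdiff_subset.trans hHG),
      Set.sdiff_union_of_subset hFH, hH.closure]

/-- `𝒫(M_F^G)`: the flats strictly between the least flat `F` and the greatest flat `G`. -/
abbrev ProperFlat (M : Matroid α) (F G : Set α) : Type _ :=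
  {H : Set α // M.IsFlat H ∧ F ⊂ H ∧ H ⊂ G}

/-- `ℝ^{𝒫(M_F^G)}`. -/
abbrev Vec (M : Matroid α) (F G : Set α) : Type _ := ProperFlat M F G → ℝ

open scoped Classical in
/-- The basis vector `δ_H` of `ℝ^{𝒫(M_F^G)}`. -/
noncomputable def delta {M : Matroid α} {F G : Set α} (H : ProperFlat M F G) : Vec M F G :=
  Pi.single H 1

open scoped Classical in
/-- `α_i = ∑_{H ∋ i} δ_H`. -/
noncomputable def alphaVec (M : Matroid α) (F G : Set α) (i : α) : Vec M F G :=
  fun H => if i ∈ H.1 then 1 else 0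

open scoped Classical in
/-- `β_i = ∑_{H ∌ i} δ_H`. -/
noncomputable def betaVec (M : Matroid α) (F G : Set α) (i : α) : Vec M F G :=
  fun H => if i ∈ H.1 then 0 else 1

/-- `W = span {α_i - α_j | i, j ∈ G \ F}`. -/
def W (M : Matroid α) (F G : Set α) : Submodule ℝ (Vec M F G) :=
  Submodule.span ℝ
    {v | ∃ i ∈ G \ F, ∃ j ∈ G \ F, v = alphaVec M F G i - alphaVec M F G j}

/-- `L = ℝ^𝒫 / W`. -/
abbrev L (M : Matroid α) (F G : Set α) : Type _ := Vec M F G ⧸ W M F G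

/-- The projection `ℝ^𝒫 → L`. -/
def proj (M : Matroid α) (F G : Set α) : Vec M F G →ₗ[ℝ] L M F G := (W M F G).mkQ

open scoped Classical in
/-- The common image `α ∈ L` of the `α_i`, for `i` in the ground set `G \ F`. -/
noncomputable def alpha (M : Matroid α) (F G : Set α) : L M F G :=
  if h : (G \ F).Nonempty then proj M F G (alphaVec M F G h.some) else 0

open scoped Classical in
/-- The common image `β ∈ L` of the `β_i`, for `i` in the ground set `G \ F`. -/
noncomputable def beta (M : Matroid α) (F G : Set α) : L M F G :=
  if h : (G \ F).Nonempty then proj M F G (betaVec M F G h.some) else 0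

/-- `alpha` does not depend on the element chosen. -/
theorem alpha_eq (M : Matroid α) {F G : Set α} {i : α} (hi : i ∈ G \ F) :
    alpha M F G = proj M F G (alphaVec M F G i) := by
  have h : (G \ F).Nonempty := ⟨i, hi⟩
  rw [alpha, dif_pos h, proj, Submodule.mkQ_apply, Submodule.mkQ_apply, Submodule.Quotient.eq]
  exact Submodule.subset_span ⟨_, h.some_mem, i, hi, rfl⟩

/-- `beta` does not depend on the element chosen. -/
theorem beta_eq (M : Matroid α) {F G : Set α} {i : α} (hi : i ∈ G \ F) :
    beta M F G = proj M F G (betaVec M F G i) := by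
  have h : (G \ F).Nonempty := ⟨i, hi⟩
  rw [beta, dif_pos h, proj, Submodule.mkQ_apply, Submodule.mkQ_apply, Submodule.Quotient.eq]
  refine Submodule.subset_span ⟨i, hi, h.some, h.some_mem, ?_⟩
  funext H
  simp only [Pi.sub_apply, alphaVec, betaVec]
  split_ifs <;> norm_num

/-- `π^H : ℝ^{𝒫(M_F^G)} → L_{M_F^H}`, the linear map with `δ_K ↦ δ_K` for `K ⊊ H`, `δ_H ↦ -α`, and
`δ_K ↦ 0` for the other `K`. -/
noncomputable def piUpper {M : Matroid α} {F G : Set α} (H : ProperFlat M F G) :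
    Vec M F G →ₗ[ℝ] L M F H.1 :=
  proj M F H.1 ∘ₗ LinearMap.funLeft ℝ ℝ
      (fun K : ProperFlat M F H.1 =>
        (⟨K.1, K.2.1, K.2.2.1, K.2.2.2.trans H.2.2.2⟩ : ProperFlat M F G))
    - (LinearMap.proj H).smulRight (alpha M F H.1)

/-- `π_H : ℝ^{𝒫(M_F^G)} → L_{M_H^G}`, the linear map with `δ_K ↦ δ_K` for `K ⊋ H`, `δ_H ↦ -β`, and
`δ_K ↦ 0` for the other `K`. -/
noncomputable def piLower {M : Matroid α} {F G : Set α} (H : ProperFlat M F G) :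
    Vec M F G →ₗ[ℝ] L M H.1 G :=
  proj M H.1 G ∘ₗ LinearMap.funLeft ℝ ℝ
      (fun K : ProperFlat M H.1 G =>
        (⟨K.1, K.2.1, H.2.2.1.trans K.2.2.1, K.2.2.2⟩ : ProperFlat M F G))
    - (LinearMap.proj H).smulRight (beta M H.1 G)

/-- The conditions that determine the volume polynomials of all the minors `M_F^G`, as functions on
`L_{M_F^G}`: the value is `1` in rank one; the value at the origin is `0` in every other rank; and
`D_H V_{M_F^G}(t) = V_{M_F^H}(π^H(t)) * V_{M_H^G}(π_H(t))`. -/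
def IsVolume (M : Matroid α) (V : ∀ F G : Set α, L M F G → ℝ) : Prop :=
  ∀ F G : Set α, M.IsFlat F → M.IsFlat G → F ⊆ G →
    (M.eRk G = M.eRk F + 1 → ∀ t, V F G t = 1) ∧
    (M.eRk G ≠ M.eRk F + 1 → V F G 0 = 0) ∧
    ∀ (H : ProperFlat M F G) (t : Vec M F G),
      HasLineDerivAt ℝ (V F G)
        (V F H.1 (piUpper H t) * V H.1 G (piLower H t))
        (proj M F G t) (proj M F G (delta H))

/-- The volume polynomials of the minors of `M`: the family characterized by `IsVolume`. -/
noncomputable def minorVolume (M : Matroid α) : ∀ F G : Set α, L M F G → ℝ :=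
  Classical.epsilon (IsVolume M)

/-- `L_M`, for a loopless matroid `M`. -/
abbrev LM (M : Matroid α) : Type _ := L M ∅ M.E

/-- The volume polynomial `V_M : L_M → ℝ` of a loopless matroid `M`. -/
noncomputable def volumePoly (M : Matroid α) : LM M → ℝ := minorVolume M ∅ M.E

/-- Strictly submodular functions on the subsets of `E` (values at other sets are irrelevant). -/
structure StrictlySubmodular (E : Set α) (c : Set α → ℝ) : Prop where
  empty : c ∅ = 0
  ground : c E = 0
  lt : ∀ I J : Set α, ∅ ⊂ I → I ⊂ E → ∅ ⊂ J → J ⊂ E → ¬ I ⊆ J → ¬ J ⊆ I →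
    c (I ∩ J) + c (I ∪ J) < c I + c J

/-- The ample cone `𝒦_M`: all `y_c = ∑_H c(H) δ_H` in `L_M` with `c` strictly submodular. -/
def ampleCone (M : Matroid α) : Set (LM M) :=
  {y | ∃ c : Set α → ℝ, StrictlySubmodular M.E c ∧
    y = proj M ∅ M.E (fun H : ProperFlat M ∅ M.E => c H.1)}

/-- The directional derivative `D_x f`, as a function. -/
noncomputable def D {X : Type*} [AddCommGroup X] [Module ℝ X] (x : X) (f : X → ℝ) : X → ℝ :=
  fun p => lineDeriv ℝ f p x

/-- The iterated directional derivative `D_{u_1} ⋯ D_{u_k} f`. -/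
noncomputable def Ds {X : Type*} [AddCommGroup X] [Module ℝ X] {k : ℕ} (u : Fin k → X)
    (f : X → ℝ) : X → ℝ :=
  (List.ofFn u).foldr D f

end MatroidVolume

open MatroidVolume

/-! The derivatives of order `d` of the volume polynomial are intersection numbers. Modulo the
constant coefficient operators annihilating V_M, the derivatives D_H satisfy the Chow ring relations
of the matroid: D_H D_K = 0 for incomparable flats, D_w = 0 for `w` in `W`, and the product over a
maximal flag has degree one. The theorem is then the mixed Hodge-Riemann inequality in degree one,
and it follows from these relations alone (`IntersectionRing`, `volumeRing`).

For a flag τ and ample u_1, ..., u_k with |τ| + k + 2 = d, let Q(x, y) be the degree of X_τ u_1 ⋯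
u_k x y. The reversed Cauchy-Schwarz inequality for Q is proved by induction on k for all flags at
once; the empty flag gives the theorem. For k = 0 a reduction modulo `W` makes Q diagonal with
nonpositive entries on a hyperplane (`cauchySchwarz_codim_two`).

The inductive step is a Bochner argument (`cauchySchwarz_cons`). Strict submodularity gives a
representative y of u = u_1 that vanishes on τ and is positive on its link
(`exists_representative`). Let A be the matrix of Q in the coordinates of the link, s = A y, and let
Q_K be the form of τ ∪ {K} with u removed. Writing one factor u as ∑ y_K X_K and applying the
induction hypothesis to each Q_K gives Q(t, t) = ∑ y_K Q_K(t, t) ≤ ∑ y_K Q_K(u, t)² / Q_K(u, u) = ∑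
y_K (A t)_K² / s_K. After rescaling, every eigenvalue of A satisfies λ ≤ λ². Since the link is
connected (`IsFlag.link_connected`), a Perron-Frobenius argument leaves only one positive direction,
that of y (`trickle_down`).

The volume polynomials themselves are built by induction on the rank, integrating the prescribed
gradient by Euler's formula (`exists_volumeAt_le`); they are unique by `volume_eq_eval`. -/

namespace MatroidVolume
open Finset

/-! ### Linear algebra of forms with one positive direction. -/

/-- A symmetric matrix with nonnegative off-diagonal entries, connected, with a positive vector `y`
satisfying `A y > 0`, and with the Bochner type inequality, is nonpositive on the orthogonal
complement of `A y`. -/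
theorem trickle_down {ι : Type*} [Fintype ι] (A : ι → ι → ℝ) (hsymm : ∀ i j, A i j = A j i)
    (hoff : ∀ i j, i ≠ j → 0 ≤ A i j)
    (hconn : ∀ z : ι → ℝ, (∀ i j, i ≠ j → 0 < A i j → z i = z j) → ∀ i j, z i = z j)
    (y s : ι → ℝ) (hy : ∀ i, 0 < y i) (hs : ∀ i, 0 < s i) (hsA : ∀ i, s i = ∑ j, A i j * y j)
    (hB : ∀ x : ι → ℝ, ∑ i, ∑ j, A i j * x i * x j ≤ ∑ i, y i * (∑ j, A i j * x j) ^ 2 / s i)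
    (x : ι → ℝ) (hx : ∑ i, s i * x i = 0) : ∑ i, ∑ j, A i j * x i * x j ≤ 0 := by
  classical
  -- With this scaling the right side of `hB` at `g * b` is the squared Euclidean norm of `S b`, so
  -- on a unit eigenvector `hB` reads λ ≤ λ².
  set g : ι → ℝ := fun i => √(y i / s i) with hg
  have hg0 : ∀ i, 0 < g i := fun i => Real.sqrt_pos.2 (div_pos (hy i) (hs i))
  have hg2 : ∀ i, g i ^ 2 = y i / s i := fun i => Real.sq_sqrt (div_pos (hy i) (hs i)).le
  set S : Matrix ι ι ℝ := Matrix.of fun i j => g i * A i j * g j with hS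
  have hH : S.IsHermitian := by
    ext i j
    simp only [Matrix.conjTranspose_apply, hS, Matrix.of_apply, star_trivial, hsymm i j]
    ring
  set b := hH.eigenvectorBasis with hb
  set lam := hH.eigenvalues with hlam
  have heig : ∀ k i, ∑ j, g i * A i j * g j * b k j = lam k * b k i := by
    intro k i
    have := congrFun (hH.mulVec_eigenvectorBasis k) i
    simpa [Matrix.mulVec, dotProduct, hS] using this
  have hnorm : ∀ k, ∑ i, b k i ^ 2 = 1 := by
    intro k
    have h1 : ‖b k‖ = 1 := b.orthonormal.1 k
    have := EuclideanSpace.norm_sq_eq (b k)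
    rw [h1] at this
    simpa using this.symm
  -- the rescaled eigenvectors
  have hquad : ∀ k, ∑ i, ∑ j, A i j * (g i * b k i) * (g j * b k j) = lam k := by
    intro k
    have : ∀ i, ∑ j, A i j * (g i * b k i) * (g j * b k j) = lam k * b k i ^ 2 := by
      intro i
      have h := congrArg (fun t => t * b k i) (heig k i)
      simp only [sum_mul] at h
      rw [sq, ← mul_assoc, ← h]
      exact sum_congr rfl fun j _ => by ring
    rw [sum_congr rfl fun i _ => this i, ← mul_sum, hnorm, mul_one]
  have hle_sq : ∀ k, lam k ≤ lam k ^ 2 := by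
    intro k
    have h := hB (fun i => g i * b k i)
    rw [hquad] at h
    refine h.trans (le_of_eq ?_)
    have : ∀ i, y i * (∑ j, A i j * (g j * b k j)) ^ 2 / s i = lam k ^ 2 * b k i ^ 2 := by
      intro i
      have h := heig k i
      have h2 : g i * (∑ j, A i j * (g j * b k j)) = lam k * b k i := by
        rw [← h, mul_sum]
        exact sum_congr rfl fun j _ => by ring
      rw [← mul_pow, ← h2, mul_pow, hg2]
      ring
    rw [sum_congr rfl fun i _ => this i, ← mul_sum, hnorm, mul_one]
  -- The Dirichlet form of `A` relative to the ground state `y`. It gives λ ≤ 1, and its vanishing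
  -- makes `g * b` proportional to `y` by connectedness. Diagonal entries of `A` do not contribute,
  -- so their sign is irrelevant.
  have hPF : ∀ k, 1 - lam k = 2⁻¹ * ∑ i, ∑ j,
      A i j * y i * y j * (g i * b k i / y i - g j * b k j / y j) ^ 2 := by
    intro k
    have hyne : ∀ i, y i ≠ 0 := fun i => (hy i).ne'
    have e1 : ∀ i j, A i j * y i * y j * (g i * b k i / y i - g j * b k j / y j) ^ 2
        = (A i j * y j) * ((g i * b k i) ^ 2 / y i) + (A j i * y i) * ((g j * b k j) ^ 2 / y j)
          - 2 * (A i j * (g i * b k i) * (g j * b k j)) := by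
      intro i j
      rw [hsymm j i]
      field_simp [hyne i, hyne j]
      ring
    have e2 : ∀ i, s i * ((g i * b k i) ^ 2 / y i) = b k i ^ 2 := by
      intro i
      rw [mul_pow, hg2]
      field_simp [hyne i, (hs i).ne']
    have e3 : ∑ i, ∑ j, (A i j * y j) * ((g i * b k i) ^ 2 / y i) = 1 := by
      rw [← hnorm k]
      refine sum_congr rfl fun i _ => ?_
      rw [← sum_mul, ← hsA, e2]
    have e4 : ∑ i, ∑ j, (A j i * y i) * ((g j * b k j) ^ 2 / y j) = 1 := by
      rw [sum_comm]; exact e3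
    simp only [e1, sum_sub_distrib, sum_add_distrib, e3, e4]
    rw [← hquad k]
    simp only [← mul_sum]
    ring
  have hpos : ∀ k i j,
      0 ≤ A i j * y i * y j * (g i * b k i / y i - g j * b k j / y j) ^ 2 := by
    intro k i j
    rcases eq_or_ne i j with rfl | hij
    · simp
    · exact mul_nonneg (mul_nonneg (mul_nonneg (hoff i j hij) (hy i).le) (hy j).le) (sq_nonneg _)
  have hle1 : ∀ k, lam k ≤ 1 := by
    intro k
    have := hPF k
    have h2 : 0 ≤ ∑ i, ∑ j, A i j * y i * y j * (g i * b k i / y i - g j * b k j / y j) ^ 2 :=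
      sum_nonneg fun i _ => sum_nonneg fun j _ => hpos k i j
    linarith
  have htop : ∀ k, 0 < lam k → ∀ i j, g i * b k i / y i = g j * b k j / y j := by
    intro k hk
    have hk1 : lam k = 1 := by
      have := hle_sq k
      have := hle1 k
      nlinarith
    refine hconn _ fun i j hij hA => ?_
    have h0 := hPF k
    rw [hk1, sub_self] at h0
    have h1 : ∑ i, ∑ j, A i j * y i * y j * (g i * b k i / y i - g j * b k j / y j) ^ 2 = 0 := by
      linarith
    have h2 := (sum_eq_zero_iff_of_nonneg fun i _ => sum_nonneg fun j _ => hpos k i j).1 h1 i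
      (mem_univ _)
    have h3 := (sum_eq_zero_iff_of_nonneg fun j _ => hpos k i j).1 h2 j (mem_univ _)
    have h4 : A i j * y i * y j ≠ 0 := (mul_pos (mul_pos hA (hy i)) (hy j)).ne'
    have h5 := (mul_eq_zero.1 h3).resolve_left h4
    exact sub_eq_zero.1 (pow_eq_zero_iff (two_ne_zero) |>.1 h5)
  -- expand `x`
  set w : EuclideanSpace ℝ ι := WithLp.toLp 2 (fun i => x i / g i) with hw
  have hwx : ∀ i, g i * w i = x i := fun i => by
    simp only [hw]
    field_simp [(hg0 i).ne']
  have hexp : ∀ i, w i = ∑ k, inner ℝ (b k) w * b k i := by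
    intro i
    have := congrArg (fun v : EuclideanSpace ℝ ι => v i) (b.sum_repr' w)
    simpa using this.symm
  have hinner : ∀ k, inner ℝ (b k) w = ∑ i, b k i * w i := by
    intro k
    simp [PiLp.inner_apply, mul_comm]
  have hval : ∑ i, ∑ j, A i j * x i * x j = ∑ k, lam k * inner ℝ (b k) w ^ 2 := by
    calc ∑ i, ∑ j, A i j * x i * x j = ∑ i, w i * ∑ j, g i * A i j * g j * w j := by
          refine sum_congr rfl fun i _ => ?_
          rw [mul_sum]
          refine sum_congr rfl fun j _ => ?_
          rw [← hwx i, ← hwx j]; ring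
      _ = ∑ i, w i * ∑ k, inner ℝ (b k) w * (lam k * b k i) := by
          refine sum_congr rfl fun i _ => ?_
          congr 1
          have : ∀ j, g i * A i j * g j * w j
              = ∑ k, inner ℝ (b k) w * (g i * A i j * g j * b k j) := by
            intro j
            conv_lhs => rw [hexp j]
            rw [mul_sum]
            exact sum_congr rfl fun k _ => by ring
          rw [sum_congr rfl fun j _ => this j, sum_comm]
          refine sum_congr rfl fun k _ => ?_
          rw [← mul_sum, heig]
      _ = ∑ k, lam k * inner ℝ (b k) w ^ 2 := by
          simp only [mul_sum]
          rw [sum_comm]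
          refine sum_congr rfl fun k _ => ?_
          conv_rhs => rw [sq, ← mul_assoc]; arg 2; rw [hinner]
          rw [mul_sum]
          exact sum_congr rfl fun i _ => by ring
  rw [hval]
  refine sum_nonpos fun k _ => ?_
  rcases le_or_gt (lam k) 0 with hk | hk
  · exact mul_nonpos_of_nonpos_of_nonneg hk (sq_nonneg _)
  -- An eigenvector with positive eigenvalue is a multiple of `y` in the original coordinates, so
  -- its pairing with `w` is a multiple of `∑ s i * x i`.
  · have h0 : inner ℝ (b k) w = 0 := by
      rw [hinner]
      rcases isEmpty_or_nonempty ι with hι | ⟨⟨i₀⟩⟩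
      · simp
      have : ∀ i, b k i * w i = g i₀ * b k i₀ / y i₀ * (s i * x i) := by
        intro i
        rw [← htop k hk i i₀, ← hwx i]
        have h1 := hg2 i
        have h2 : g i * g i * s i = y i := by
          rw [← sq, h1, div_mul_cancel₀ _ (hs i).ne']
        field_simp [(hy i).ne']
        linear_combination (-(b k i * w i)) * h2
      rw [sum_congr rfl fun i _ => this i, ← mul_sum, hx, mul_zero]
    rw [h0]; simp

/-- A bilinear form that is nonpositive on a hyperplane of a subspace satisfies the reversed
Cauchy-Schwarz inequality there. -/
theorem reverse_cauchySchwarz {V : Type*} [AddCommGroup V] [Module ℝ V] (N : Submodule ℝ V)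
    (A : V →ₗ[ℝ] V →ₗ[ℝ] ℝ) (hsymm : ∀ x y, A x y = A y x)
    (hL : ∃ φ : V →ₗ[ℝ] ℝ, ∀ w ∈ N, φ w = 0 → A w w ≤ 0) {v x : V} (hvN : v ∈ N) (hxN : x ∈ N)
    (hv : 0 < A v v) : A v v * A x x ≤ A v x ^ 2 := by
  obtain ⟨φ, hφ⟩ := hL
  have hφv : φ v ≠ 0 := fun h => not_le.2 hv (hφ v hvN h)
  -- Sliding `x` along `v` into the kernel of `φ` gives a quadratic inequality in the coefficient;
  -- completing the square removes it.
  have h := hφ (x - (φ x / φ v) • v) (N.sub_mem hxN (N.smul_mem _ hvN)) (by simp [hφv])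
  simp only [map_sub, map_smul, LinearMap.sub_apply, LinearMap.smul_apply, smul_eq_mul,
    hsymm x v] at h
  nlinarith [mul_le_mul_of_nonneg_left h hv.le, sq_nonneg (A v x - φ x / φ v * A v v)]

end MatroidVolume

/-! ### Ranks, covers and chains of flats. -/

namespace MatroidVolume
open Matroid

variable {α : Type*}

/-- The rank of a set, as a natural number. -/
noncomputable def rk (M : Matroid α) (X : Set α) : ℕ := (M.eRk X).toNat

section Rank

variable {M : Matroid α} [M.RankFinite] {F G H K X Y : Set α} {e : α}

theorem coe_rk (M : Matroid α) [M.RankFinite] (X : Set α) : (rk M X : ℕ∞) = M.eRk X :=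
  ENat.natCast_toNat (eRk_ne_top_iff.2 (M.isRkFinite_set X))

theorem rk_mono (h : X ⊆ Y) : rk M X ≤ rk M Y := by
  have := M.eRk_mono h
  rw [← coe_rk, ← coe_rk] at this
  exact_mod_cast this

theorem rk_closure_insert (hF : M.IsFlat F) (he : e ∈ M.E) (heF : e ∉ F) :
    rk M (M.closure (insert e F)) = rk M F + 1 := by
  have h := M.eRk_insert_eq_add_one (e := e) (X := F) ⟨he, by rwa [hF.closure]⟩
  rw [← eRk_closure_eq, ← coe_rk, ← coe_rk] at h
  exact_mod_cast h

/-- The flat covering `F` through `e`. -/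
theorem exists_cover (hF : M.IsFlat F) (hG : M.IsFlat G) (hFG : F ⊆ G) (he : e ∈ G) (heF : e ∉ F) :
    ∃ p, M.IsFlat p ∧ F ⊂ p ∧ e ∈ p ∧ p ⊆ G ∧ rk M p = rk M F + 1 ∧
      ∀ K, M.IsFlat K → F ⊆ K → e ∈ K → p ⊆ K := by
  have heE := hG.subset_ground he
  have hins : insert e F ⊆ M.E := Set.insert_subset heE hF.subset_ground
  have hmin : ∀ K, M.IsFlat K → F ⊆ K → e ∈ K → M.closure (insert e F) ⊆ K := fun K hK hFK heK => by
    have := M.closure_subset_closure (Set.insert_subset heK hFK)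
    rwa [hK.closure] at this
  have hsub := M.subset_closure _ hins
  refine ⟨M.closure (insert e F), isFlat_closure _, ?_, hsub (Set.mem_insert e F), hmin G hG hFG he,
    rk_closure_insert hF heE heF, hmin⟩
  exact (Set.ssubset_iff_of_subset ((Set.subset_insert e F).trans hsub)).2
    ⟨e, hsub (Set.mem_insert e F), heF⟩

theorem rk_lt_rk (hF : M.IsFlat F) (hG : M.IsFlat G) (h : F ⊂ G) : rk M F < rk M G := by
  obtain ⟨e, heG, heF⟩ := Set.exists_of_ssubset h
  obtain ⟨p, -, -, -, hpG, hr, -⟩ := exists_cover hF hG h.subset heG heF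
  have := rk_mono (M := M) hpG
  omega

theorem eq_of_rk_le (hF : M.IsFlat F) (hG : M.IsFlat G) (h : F ⊆ G) (hr : rk M G ≤ rk M F) :
    F = G := by
  by_contra hne
  exact absurd (rk_lt_rk hF hG (h.ssubset_of_ne hne)) (not_lt.2 hr)

theorem rk_empty (M : Matroid α) : rk M ∅ = 0 := by simp [rk]

theorem isFlat_empty (M : Matroid α) [M.Loopless] : M.IsFlat ∅ := by
  rw [isFlat_iff_closure_eq]; exact M.loops_eq_empty

/-- The rank is injective on a chain of flats, with values strictly between the ranks of `F` and
`G`. -/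
theorem chain_card_lt {σ : Finset (Set α)} (hF : M.IsFlat F) (hG : M.IsFlat G) (hFG : F ⊂ G)
    (hσ : ∀ H ∈ σ, M.IsFlat H ∧ F ⊂ H ∧ H ⊂ G)
    (hc : ∀ H ∈ σ, ∀ K ∈ σ, H ⊆ K ∨ K ⊆ H) : σ.card + 1 + rk M F ≤ rk M G := by
  have h : σ.card ≤ (Finset.Ioo (rk M F) (rk M G)).card := by
    refine Finset.card_le_card_of_injOn (rk M) (fun H hH => ?_) (fun H hH K hK hr => ?_)
    · obtain ⟨hH1, hH2, hH3⟩ := hσ H hH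
      exact Finset.mem_coe.2 (Finset.mem_Ioo.2 ⟨rk_lt_rk hF hH1 hH2, rk_lt_rk hH1 hG hH3⟩)
    · rcases hc H hH K hK with h | h
      · exact eq_of_rk_le (hσ H hH).1 (hσ K hK).1 h hr.ge
      · exact (eq_of_rk_le (hσ K hK).1 (hσ H hH).1 h hr.le).symm
  rw [Nat.card_Ioo] at h
  have := rk_lt_rk hF hG hFG
  omega

theorem exists_top {σ : Finset (Set α)} (hne : σ.Nonempty)
    (hc : ∀ H ∈ σ, ∀ K ∈ σ, H ⊆ K ∨ K ⊆ H) : ∃ H ∈ σ, ∀ K ∈ σ, K ⊆ H := by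
  obtain ⟨H, hH⟩ := σ.exists_maximal hne
  refine ⟨H, hH.1, fun K hK => ?_⟩
  rcases hc H hH.1 K hK with h | h
  · exact hH.2 hK h
  · exact h

/-- A chain that is not maximal has a gap. -/
theorem exists_gap {σ : Finset (Set α)} (hF : M.IsFlat F) (hG : M.IsFlat G) (hFG : F ⊂ G)
    (hσ : ∀ H ∈ σ, M.IsFlat H ∧ F ⊂ H ∧ H ⊂ G)
    (hc : ∀ H ∈ σ, ∀ K ∈ σ, H ⊆ K ∨ K ⊆ H) (hcard : σ.card + 1 + rk M F < rk M G) :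
    ∃ F' G', M.IsFlat F' ∧ M.IsFlat G' ∧ F ⊆ F' ∧ F' ⊂ G' ∧ G' ⊆ G ∧ rk M F' + 2 ≤ rk M G' ∧
      (∀ H ∈ σ, H ⊆ F' ∨ G' ⊆ H) ∧ (F' = F ∨ F' ∈ σ) ∧ (G' = G ∨ G' ∈ σ) := by
  classical
  induction hn : σ.card generalizing σ G with
  | zero =>
    obtain rfl := Finset.card_eq_zero.1 hn
    exact ⟨F, G, hF, hG, subset_rfl, hFG, subset_rfl, by simp at hcard; omega, by simp,
      Or.inl rfl, Or.inl rfl⟩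
  | succ n ih =>
    obtain ⟨H, hH, hmax⟩ := exists_top (Finset.card_pos.1 (by omega)) hc
    obtain ⟨hH1, hH2, hH3⟩ := hσ H hH
    have hlt := rk_lt_rk hH1 hG hH3
    -- Either the gap lies above the largest member, or that member has corank one in `G` and a gap
    -- remains below it.
    by_cases hgap : rk M H + 2 ≤ rk M G
    · exact ⟨H, G, hH1, hG, hH2.subset, hH3, subset_rfl, hgap, fun K hK => Or.inl (hmax K hK),
        Or.inr hH, Or.inl rfl⟩
    have hce : (σ.erase H).card = n := by rw [Finset.card_erase_of_mem hH, hn]; rfl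
    obtain ⟨F', G', h1, h2, h3, h4, h5, h6, h7, h8, h9⟩ := ih hH1 hH2 (σ := σ.erase H)
      (fun K hK => by
        have hK' := Finset.mem_of_mem_erase hK
        exact ⟨(hσ K hK').1, (hσ K hK').2.1,
          (hmax K hK').ssubset_of_ne (Finset.ne_of_mem_erase hK)⟩)
      (fun K hK L hL => hc K (Finset.mem_of_mem_erase hK) L (Finset.mem_of_mem_erase hL))
      (by omega) hce
    refine ⟨F', G', h1, h2, h3, h4, h5.trans hH3.subset, h6, fun K hK => ?_,
      h8.imp_right Finset.mem_of_mem_erase, Or.inr ?_⟩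
    by_cases hKH : K = H
    · subst hKH; exact Or.inr h5
    · exact h7 K (Finset.mem_erase.2 ⟨hKH, hK⟩)
    · rcases h9 with rfl | h9
      · exact hH
      · exact Finset.mem_of_mem_erase h9

end Rank
end MatroidVolume

/-! ### Directional derivatives of polynomials. -/

namespace MatroidVolume
open Matroid MvPolynomial

section DirectionalDerivative

variable {S T : Type*}

/-- The directional derivative of polynomials along a constant vector. -/
noncomputable def dd (x : S → ℝ) : Derivation ℝ (MvPolynomial S ℝ) (MvPolynomial S ℝ) :=
  mkDerivation ℝ fun i => C (x i)

@[simp] theorem dd_X (x : S → ℝ) (i : S) : dd x (X i) = C (x i) := mkDerivation_X _ _ _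

@[simp] theorem dd_C (x : S → ℝ) (a : ℝ) : dd x (C a) = 0 := derivation_C _ _

theorem dd_add (x y : S → ℝ) : dd (x + y) = dd x + dd y :=
  derivation_ext fun i => by simp

theorem dd_smul (c : ℝ) (x : S → ℝ) : dd (c • x) = c • dd x :=
  derivation_ext fun i => by simp [smul_eq_C_mul]

/-- `dd` as a linear map. -/
noncomputable def ddₗ : (S → ℝ) →ₗ[ℝ] Module.End ℝ (MvPolynomial S ℝ) where
  toFun x := (dd x).toLinearMap
  map_add' x y := by rw [dd_add]; rfl
  map_smul' c x := by rw [dd_smul]; rfl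

theorem ddₗ_apply (x : S → ℝ) (P : MvPolynomial S ℝ) : ddₗ x P = dd x P := rfl

theorem dd_zero_apply (P : MvPolynomial S ℝ) : dd (0 : S → ℝ) P = 0 := by
  rw [← ddₗ_apply, map_zero, LinearMap.zero_apply]

theorem dd_single [DecidableEq S] (i : S) : dd (Pi.single i 1) = pderiv i :=
  derivation_ext fun j => by
    rcases eq_or_ne j i with rfl | h
    · simp
    · simp [pderiv_X_of_ne h, h]

theorem dd_comm (x y : S → ℝ) (P : MvPolynomial S ℝ) : dd x (dd y P) = dd y (dd x P) := by
  have h : ⁅dd x, dd y⁆ = 0 := derivation_ext fun i => by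
    simp [Derivation.commutator_apply]
  have := congrArg (fun D => D P) h
  simpa [Derivation.commutator_apply, sub_eq_zero] using this

/-- The chain rule for a substitution whose derivative along `x` is constant, in particular for
linear changes of variables. -/
theorem dd_aeval {g : S → MvPolynomial T ℝ} {x : T → ℝ} {x' : S → ℝ}
    (h : ∀ i, dd x (g i) = C (x' i)) (P : MvPolynomial S ℝ) :
    dd x (aeval g P) = aeval g (dd x' P) := by
  induction P using MvPolynomial.induction_on with
  | C a => simp [algebraMap_eq]
  | add p q hp hq => rw [map_add, map_add, hp, hq, map_add, map_add]
  | mul_X p i hp =>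
    rw [map_mul, Derivation.leibniz, hp, aeval_X, h, Derivation.leibniz, dd_X]
    simp [algebraMap_eq]

theorem hasDerivAt_eval (p x : S → ℝ) (P : MvPolynomial S ℝ) (s : ℝ) :
    HasDerivAt (fun s : ℝ => eval (p + s • x) P) (eval (p + s • x) (dd x P)) s := by
  induction P using MvPolynomial.induction_on with
  | C a => simpa using hasDerivAt_const s a
  | add P Q hP hQ => simpa using! hP.add hQ
  | mul_X P i hP =>
    have h1 : HasDerivAt (fun s : ℝ => p i + s * x i) (x i) s := by
      simpa using ((hasDerivAt_id s).mul_const (x i)).const_add (p i)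
    have := hP.mul h1
    simp only [map_mul, eval_X, Pi.add_apply, Pi.smul_apply, smul_eq_mul]
    refine this.congr_deriv ?_
    rw [Derivation.leibniz, dd_X]
    simp only [map_add, smul_eq_mul, map_mul, eval_X, eval_C, Pi.add_apply, Pi.smul_apply]
    ring

theorem hasLineDerivAt_eval (p x : S → ℝ) (P : MvPolynomial S ℝ) :
    HasLineDerivAt ℝ (fun t => eval t P) (eval p (dd x P)) p x := by
  have := hasDerivAt_eval p x P 0
  simpa [HasLineDerivAt] using this

theorem eval_add_of_dd_eq_zero {x : S → ℝ} {P : MvPolynomial S ℝ} (h : dd x P = 0) (p : S → ℝ) :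
    eval (p + x) P = eval p P := by
  have h1 : ∀ s, HasDerivAt (fun s : ℝ => eval (p + s • x) P) 0 s := fun s => by
    simpa [h] using hasDerivAt_eval p x P s
  have := is_const_of_deriv_eq_zero (fun s => (h1 s).differentiableAt) (fun s => (h1 s).deriv) 1 0
  simpa using this

variable [Fintype S]

theorem dd_eq_sum (x : S → ℝ) (P : MvPolynomial S ℝ) : dd x P = ∑ i, C (x i) * pderiv i P := by
  classical
  conv_lhs => rw [← ddₗ_apply, pi_eq_sum_univ' x, map_sum, LinearMap.sum_apply]
  refine Finset.sum_congr rfl fun i _ => ?_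
  rw [map_smul, LinearMap.smul_apply, ddₗ_apply, smul_eq_C_mul, dd_single]

theorem isHomogeneous_dd {n : ℕ} {P : MvPolynomial S ℝ} (h : P.IsHomogeneous n) (x : S → ℝ) :
    (dd x P).IsHomogeneous (n - 1) := by
  rw [dd_eq_sum]
  refine IsHomogeneous.sum _ _ _ fun i _ => ?_
  have := (isHomogeneous_C S (x i)).mul (h.pderiv (i := i))
  rwa [zero_add] at this

end DirectionalDerivative

/-! ### Lifts of π^H and π_H to vectors and polynomials. -/

variable {α : Type*} {M : Matroid α} {F G : Set α}

theorem delta_apply (H K : ProperFlat M F G) [Decidable (K = H)] :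
    (delta H : Vec M F G) K = if K = H then 1 else 0 := by
  rw [delta, Pi.single_apply]; congr

theorem dd_delta (H : ProperFlat M F G) : dd (delta H : Vec M F G) = pderiv H := by
  classical
  rw [← dd_single]
  congr 1

/-- A proper flat of `M_F^H` as a proper flat of `M_F^G`. -/
def inclUpper (H : ProperFlat M F G) (K : ProperFlat M F H.1) : ProperFlat M F G :=
  ⟨K.1, K.2.1, K.2.2.1, K.2.2.2.trans H.2.2.2⟩

/-- A proper flat of `M_H^G` as a proper flat of `M_F^G`. -/
def inclLower (H : ProperFlat M F G) (K : ProperFlat M H.1 G) : ProperFlat M F G :=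
  ⟨K.1, K.2.1, H.2.2.1.trans K.2.2.1, K.2.2.2⟩

theorem alphaVec_of_mem {H : ProperFlat M F G} {i : α} (h : i ∈ H.1) : alphaVec M F G i H = 1 :=
  if_pos h

theorem alphaVec_of_notMem {H : ProperFlat M F G} {i : α} (h : i ∉ H.1) :
    alphaVec M F G i H = 0 :=
  if_neg h

theorem betaVec_of_mem {H : ProperFlat M F G} {i : α} (h : i ∈ H.1) : betaVec M F G i H = 0 :=
  if_pos h

theorem alphaVec_inclUpper (H : ProperFlat M F G) (K : ProperFlat M F H.1) (i : α) :
    alphaVec M F G i (inclUpper H K) = alphaVec M F H.1 i K := rfl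

theorem alphaVec_inclLower (H : ProperFlat M F G) (K : ProperFlat M H.1 G) (i : α) :
    alphaVec M F G i (inclLower H K) = alphaVec M H.1 G i K := rfl

/-- The lift of `π^H` to vectors defined by an element `i` of `H \ F`. -/
noncomputable def upperVec (H : ProperFlat M F G) (i : α) : Vec M F G →ₗ[ℝ] Vec M F H.1 :=
  LinearMap.funLeft ℝ ℝ (inclUpper H) - (LinearMap.proj H).smulRight (alphaVec M F H.1 i)

/-- The lift of `π_H` to vectors defined by an element `j` of `G \ H`. -/
noncomputable def lowerVec (H : ProperFlat M F G) (j : α) : Vec M F G →ₗ[ℝ] Vec M H.1 G :=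
  LinearMap.funLeft ℝ ℝ (inclLower H) - (LinearMap.proj H).smulRight (betaVec M H.1 G j)

theorem upperVec_apply (H : ProperFlat M F G) (i : α) (t : Vec M F G) (K : ProperFlat M F H.1) :
    upperVec H i t K = t (inclUpper H K) - t H * alphaVec M F H.1 i K := rfl

theorem lowerVec_apply (H : ProperFlat M F G) (j : α) (t : Vec M F G) (K : ProperFlat M H.1 G) :
    lowerVec H j t K = t (inclLower H K) - t H * betaVec M H.1 G j K := rfl

theorem proj_upperVec (H : ProperFlat M F G) {i : α} (hi : i ∈ H.1 \ F) (t : Vec M F G) :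
    proj M F H.1 (upperVec H i t) = piUpper H t := by
  simp only [upperVec, piUpper, LinearMap.sub_apply, LinearMap.smulRight_apply, map_sub, map_smul,
    alpha_eq M hi]
  rfl

theorem proj_lowerVec (H : ProperFlat M F G) {j : α} (hj : j ∈ G \ H.1) (t : Vec M F G) :
    proj M H.1 G (lowerVec H j t) = piLower H t := by
  simp only [lowerVec, piLower, LinearMap.sub_apply, LinearMap.smulRight_apply, map_sub, map_smul,
    beta_eq M hj]
  rfl

theorem proj_eq_proj {t t' : Vec M F G} : proj M F G t = proj M F G t' ↔ t - t' ∈ W M F G :=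
  Submodule.Quotient.eq _

theorem alphaVec_sub_mem {i j : α} (hi : i ∈ G \ F) (hj : j ∈ G \ F) :
    alphaVec M F G i - alphaVec M F G j ∈ W M F G :=
  Submodule.subset_span ⟨i, hi, j, hj, rfl⟩

/-- The lift sends α_i to α_i - α_k if `i ∈ H` and to 0 otherwise, so it descends to the quotients.
-/
theorem upperVec_mem_W (H : ProperFlat M F G) {k : α} (hk : k ∈ H.1 \ F) {w : Vec M F G}
    (hw : w ∈ W M F G) : upperVec H k w ∈ W M F H.1 := by
  refine Submodule.span_induction (p := fun w _ => upperVec H k w ∈ W M F H.1) ?_ ?_ ?_ ?_ hw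
  · rintro _ ⟨i, hi, j, hj, rfl⟩
    have key : ∀ i, i ∈ G \ F → upperVec H k (alphaVec M F G i) ∈ W M F H.1 := by
      intro i hi
      by_cases h : i ∈ H.1
      · have : upperVec H k (alphaVec M F G i) = alphaVec M F H.1 i - alphaVec M F H.1 k := by
          ext K
          simp [upperVec_apply, alphaVec_inclUpper, alphaVec_of_mem (H := H) h]
        rw [this]
        exact alphaVec_sub_mem ⟨h, hi.2⟩ hk
      · have : upperVec H k (alphaVec M F G i) = 0 := by
          ext K
          have : i ∉ K.1 := fun h' => h (K.2.2.2.subset h')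
          simp [upperVec_apply, alphaVec, inclUpper, h, this]
        rw [this]
        exact zero_mem _
    rw [map_sub]
    exact sub_mem (key i hi) (key j hj)
  · rw [map_zero]; exact zero_mem _
  · intro x y _ _ hx hy
    rw [map_add]; exact add_mem hx hy
  · intro c x _ hx
    rw [map_smul]; exact Submodule.smul_mem _ _ hx

/-- Flats above `H` contain all of `H`. Hence α_i goes to 1 - β_k = α_k if `i ∈ H`, and to α_i
otherwise, and all these images agree modulo `W`. -/
theorem lowerVec_mem_W (H : ProperFlat M F G) {k : α} (hk : k ∈ G \ H.1) {w : Vec M F G}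
    (hw : w ∈ W M F G) : lowerVec H k w ∈ W M H.1 G := by
  refine Submodule.span_induction (p := fun w _ => lowerVec H k w ∈ W M H.1 G) ?_ ?_ ?_ ?_ hw
  · rintro _ ⟨i, hi, j, hj, rfl⟩
    have key : ∀ i, i ∈ G \ F →
        lowerVec H k (alphaVec M F G i) - alphaVec M H.1 G k ∈ W M H.1 G := by
      intro i hi
      by_cases h : i ∈ H.1
      · have : lowerVec H k (alphaVec M F G i) - alphaVec M H.1 G k = 0 := by
          ext K
          have : i ∈ K.1 := K.2.2.1.subset h
          by_cases hk' : k ∈ K.1 <;>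
            simp [lowerVec_apply, alphaVec, betaVec, inclLower, h, this, hk']
        rw [this]
        exact zero_mem _
      · have : lowerVec H k (alphaVec M F G i) - alphaVec M H.1 G k
            = alphaVec M H.1 G i - alphaVec M H.1 G k := by
          ext K
          simp [lowerVec_apply, alphaVec_inclLower, alphaVec_of_notMem (H := H) h]
        rw [this]
        exact alphaVec_sub_mem ⟨hi.1, h⟩ hk
    rw [map_sub, ← sub_sub_sub_cancel_right _ _ (alphaVec M H.1 G k)]
    exact sub_mem (key i hi) (key j hj)
  · rw [map_zero]; exact zero_mem _
  · intro x y _ _ hx hy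
    rw [map_add]; exact add_mem hx hy
  · intro c x _ hx
    rw [map_smul]; exact Submodule.smul_mem _ _ hx

/-- The substitution of `upperVec` into polynomials. -/
noncomputable def upperHom (H : ProperFlat M F G) (i : α) :
    MvPolynomial (ProperFlat M F H.1) ℝ →ₐ[ℝ] MvPolynomial (ProperFlat M F G) ℝ :=
  aeval fun K => X (inclUpper H K) - C (alphaVec M F H.1 i K) * X H

/-- The substitution of `lowerVec` into polynomials. -/
noncomputable def lowerHom (H : ProperFlat M F G) (j : α) :
    MvPolynomial (ProperFlat M H.1 G) ℝ →ₐ[ℝ] MvPolynomial (ProperFlat M F G) ℝ :=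
  aeval fun K => X (inclLower H K) - C (betaVec M H.1 G j K) * X H

theorem upperHom_X (H : ProperFlat M F G) (i : α) (K : ProperFlat M F H.1) :
    upperHom H i (X K) = X (inclUpper H K) - C (alphaVec M F H.1 i K) * X H := aeval_X _ _

theorem lowerHom_X (H : ProperFlat M F G) (j : α) (K : ProperFlat M H.1 G) :
    lowerHom H j (X K) = X (inclLower H K) - C (betaVec M H.1 G j K) * X H := aeval_X _ _

theorem dd_upperHom (H : ProperFlat M F G) (i : α) (x : Vec M F G)
    (Q : MvPolynomial (ProperFlat M F H.1) ℝ) :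
    dd x (upperHom H i Q) = upperHom H i (dd (upperVec H i x) Q) := by
  refine dd_aeval (fun K => ?_) Q
  rw [map_sub, Derivation.leibniz, dd_X, dd_X, dd_C, upperVec_apply, map_sub, map_mul]
  simp only [smul_eq_mul, mul_zero, add_zero]
  rw [mul_comm]

theorem dd_lowerHom (H : ProperFlat M F G) (j : α) (x : Vec M F G)
    (Q : MvPolynomial (ProperFlat M H.1 G) ℝ) :
    dd x (lowerHom H j Q) = lowerHom H j (dd (lowerVec H j x) Q) := by
  refine dd_aeval (fun K => ?_) Q
  rw [map_sub, Derivation.leibniz, dd_X, dd_X, dd_C, lowerVec_apply, map_sub, map_mul]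
  simp only [smul_eq_mul, mul_zero, add_zero]
  rw [mul_comm]

theorem eval_upperHom (H : ProperFlat M F G) (i : α) (t : Vec M F G)
    (Q : MvPolynomial (ProperFlat M F H.1) ℝ) :
    eval t (upperHom H i Q) = eval (upperVec H i t) Q := by
  induction Q using MvPolynomial.induction_on with
  | C a => simp [← algebraMap_eq]
  | add p q hp hq => simp [hp, hq]
  | mul_X p K hp =>
    rw [map_mul, map_mul, hp, upperHom_X, map_mul, eval_X, upperVec_apply]
    simp [mul_comm]

theorem eval_lowerHom (H : ProperFlat M F G) (j : α) (t : Vec M F G)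
    (Q : MvPolynomial (ProperFlat M H.1 G) ℝ) :
    eval t (lowerHom H j Q) = eval (lowerVec H j t) Q := by
  induction Q using MvPolynomial.induction_on with
  | C a => simp [← algebraMap_eq]
  | add p q hp hq => simp [hp, hq]
  | mul_X p K hp =>
    rw [map_mul, map_mul, hp, lowerHom_X, map_mul, eval_X, lowerVec_apply]
    simp [mul_comm]

theorem eval_eq_of_sub_mem {Q : MvPolynomial (ProperFlat M F G) ℝ}
    (hQ : ∀ w ∈ W M F G, dd w Q = 0) {t t' : Vec M F G} (h : t - t' ∈ W M F G) :
    eval t Q = eval t' Q := by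
  have := eval_add_of_dd_eq_zero (hQ _ h) t'
  rwa [add_sub_cancel] at this

/-- Changing the chosen element moves the substituted vector by an element of `W`, under which `Q`
is invariant. -/
theorem upperHom_eq (H : ProperFlat M F G) {i i' : α} (hi : i ∈ H.1 \ F) (hi' : i' ∈ H.1 \ F)
    {Q : MvPolynomial (ProperFlat M F H.1) ℝ} (hQ : ∀ w ∈ W M F H.1, dd w Q = 0) :
    upperHom H i Q = upperHom H i' Q := by
  refine MvPolynomial.funext fun t => ?_
  rw [eval_upperHom, eval_upperHom]
  refine eval_eq_of_sub_mem hQ ?_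
  rw [← proj_eq_proj, proj_upperVec H hi, proj_upperVec H hi']

theorem lowerHom_eq (H : ProperFlat M F G) {j j' : α} (hj : j ∈ G \ H.1) (hj' : j' ∈ G \ H.1)
    {Q : MvPolynomial (ProperFlat M H.1 G) ℝ} (hQ : ∀ w ∈ W M H.1 G, dd w Q = 0) :
    lowerHom H j Q = lowerHom H j' Q := by
  refine MvPolynomial.funext fun t => ?_
  rw [eval_lowerHom, eval_lowerHom]
  refine eval_eq_of_sub_mem hQ ?_
  rw [← proj_eq_proj, proj_lowerVec H hj, proj_lowerVec H hj']

theorem isHomogeneous_upperHom (H : ProperFlat M F G) (i : α) {n : ℕ}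
    {Q : MvPolynomial (ProperFlat M F H.1) ℝ} (hQ : Q.IsHomogeneous n) :
    (upperHom H i Q).IsHomogeneous n := by
  have := hQ.aeval (fun K => X (inclUpper H K) - C (alphaVec M F H.1 i K) * X H) (n := 1)
    fun K => (isHomogeneous_X ℝ _).sub
      (by simpa using (isHomogeneous_C _ (alphaVec M F H.1 i K)).mul (isHomogeneous_X ℝ H))
  rwa [one_mul] at this

theorem isHomogeneous_lowerHom (H : ProperFlat M F G) (j : α) {n : ℕ}
    {Q : MvPolynomial (ProperFlat M H.1 G) ℝ} (hQ : Q.IsHomogeneous n) :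
    (lowerHom H j Q).IsHomogeneous n := by
  have := hQ.aeval (fun K => X (inclLower H K) - C (betaVec M H.1 G j K) * X H) (n := 1)
    fun K => (isHomogeneous_X ℝ _).sub
      (by simpa using (isHomogeneous_C _ (betaVec M H.1 G j K)).mul (isHomogeneous_X ℝ H))
  rwa [one_mul] at this

end MatroidVolume

/-! ### Existence of the volume polynomials. -/

namespace MatroidVolume
open Matroid MvPolynomial

variable {α : Type*} {M : Matroid α} {F G : Set α}

instance finite_properFlat [M.Finite] (F G : Set α) : Finite (ProperFlat M F G) := by
  have : {H : Set α | M.IsFlat H ∧ F ⊂ H ∧ H ⊂ G}.Finite :=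
    M.ground_finite.finite_subsets.subset fun H hH => hH.1.subset_ground
  exact this

noncomputable instance fintype_properFlat [M.Finite] (F G : Set α) :
    Fintype (ProperFlat M F G) := Fintype.ofFinite _

theorem exists_mem_sdiff_upper (H : ProperFlat M F G) : ∃ i, i ∈ H.1 \ F :=
  Set.exists_of_ssubset H.2.2.1

theorem exists_mem_sdiff_lower (H : ProperFlat M F G) : ∃ j, j ∈ G \ H.1 :=
  Set.exists_of_ssubset H.2.2.2

/-- The properties of the volume polynomial of `M_F^G`, relative to those of its minors. -/
structure VolumeAt (M : Matroid α) (P : ∀ F G : Set α, MvPolynomial (ProperFlat M F G) ℝ)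
    (F G : Set α) : Prop where
  one : rk M G = rk M F + 1 → P F G = 1
  zero : rk M G = rk M F → P F G = 0
  homogeneous : (P F G).IsHomogeneous (rk M G - rk M F - 1)
  invariant : ∀ w ∈ W M F G, dd w (P F G) = 0
  deriv : ∀ (H : ProperFlat M F G) (i j : α), i ∈ H.1 \ F → j ∈ G \ H.1 →
    dd (delta H) (P F G) = upperHom H i (P F H.1) * lowerHom H j (P H.1 G)

theorem upperVec_delta_of_not_subset {H K : ProperFlat M F G} (h : ¬ K.1 ⊆ H.1) (i : α) :
    upperVec H i (delta K) = 0 := by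
  classical
  ext J
  have h1 : inclUpper H J ≠ K := by rintro rfl; exact h J.2.2.2.subset
  have h2 : H ≠ K := by rintro rfl; exact h subset_rfl
  simp [upperVec_apply, delta_apply, h1, h2]

theorem lowerVec_delta_of_not_subset {H K : ProperFlat M F G} (h : ¬ H.1 ⊆ K.1) (j : α) :
    lowerVec H j (delta K) = 0 := by
  classical
  ext J
  have h1 : inclLower H J ≠ K := by rintro rfl; exact h J.2.2.1.subset
  have h2 : H ≠ K := by rintro rfl; exact h subset_rfl
  simp [lowerVec_apply, delta_apply, h1, h2]

theorem upperVec_delta_inclUpper (H : ProperFlat M F G) (K : ProperFlat M F H.1) (i : α) :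
    upperVec H i (delta (inclUpper H K)) = delta K := by
  classical
  ext J
  have h2 : H ≠ inclUpper H K := fun h => K.2.2.2.ne (congrArg Subtype.val h).symm
  have h3 : inclUpper H J = inclUpper H K ↔ J = K := by
    simp [inclUpper, Subtype.ext_iff]
  simp [upperVec_apply, delta_apply, h3, h2]

theorem lowerVec_delta_inclLower (H : ProperFlat M F G) (K : ProperFlat M H.1 G) (j : α) :
    lowerVec H j (delta (inclLower H K)) = delta K := by
  classical
  ext J
  have h2 : H ≠ inclLower H K := fun h => K.2.2.1.ne (congrArg Subtype.val h)
  have h3 : inclLower H J = inclLower H K ↔ J = K := by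
    simp [inclLower, Subtype.ext_iff]
  simp [lowerVec_apply, delta_apply, h3, h2]

section Compositions

variable {H K : ProperFlat M F G} (hKH : K.1 ⊂ H.1)

/-- The corrections made by the outer substitution carry the values of α_i at `K` and at flats below
it, which vanish as `i ∉ K`. Choosing the element this way gives identities of polynomials and not
merely identities modulo `W`; the next two lemmas work alike. -/
theorem upperHom_upperHom {i i' : α} (hi : i ∉ K.1)
    (Q : MvPolynomial (ProperFlat M F K.1) ℝ) :
    upperHom H i (upperHom (⟨K.1, K.2.1, K.2.2.1, hKH⟩ : ProperFlat M F H.1) i' Q)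
      = upperHom K i' Q := by
  suffices h : (upperHom H i).comp
      (upperHom (⟨K.1, K.2.1, K.2.2.1, hKH⟩ : ProperFlat M F H.1) i') = upperHom K i' from
    congrArg (fun φ => φ Q) h
  refine MvPolynomial.algHom_ext fun J => ?_
  have hJ : i ∉ J.1 := fun h => hi (J.2.2.2.subset h)
  have hC : ∀ (r : ℝ), upperHom H i (C r) = C r := fun r => (upperHom H i).commutes r
  rw [AlgHom.comp_apply, upperHom_X, map_sub, map_mul, upperHom_X, upperHom_X, upperHom_X, hC,
    alphaVec_of_notMem (H := (⟨K.1, K.2.1, K.2.2.1, hKH⟩ : ProperFlat M F H.1)) hi,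
    alphaVec_of_notMem (H := inclUpper (⟨K.1, K.2.1, K.2.2.1, hKH⟩ : ProperFlat M F H.1) J) hJ]
  simp only [map_zero, zero_mul, sub_zero]
  rfl

theorem lowerHom_lowerHom {j j' : α} (hj : j ∈ H.1)
    (Q : MvPolynomial (ProperFlat M H.1 G) ℝ) :
    lowerHom K j (lowerHom (⟨H.1, H.2.1, hKH, H.2.2.2⟩ : ProperFlat M K.1 G) j' Q)
      = lowerHom H j' Q := by
  suffices h : (lowerHom K j).comp
      (lowerHom (⟨H.1, H.2.1, hKH, H.2.2.2⟩ : ProperFlat M K.1 G) j') = lowerHom H j' from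
    congrArg (fun φ => φ Q) h
  refine MvPolynomial.algHom_ext fun J => ?_
  have hJ : j ∈ J.1 := J.2.2.1.subset hj
  have hC : ∀ (r : ℝ), lowerHom K j (C r) = C r := fun r => (lowerHom K j).commutes r
  rw [AlgHom.comp_apply, lowerHom_X, map_sub, map_mul, lowerHom_X, lowerHom_X, lowerHom_X, hC,
    betaVec_of_mem (H := (⟨H.1, H.2.1, hKH, H.2.2.2⟩ : ProperFlat M K.1 G)) hj,
    betaVec_of_mem (H := inclLower (⟨H.1, H.2.1, hKH, H.2.2.2⟩ : ProperFlat M K.1 G) J) hJ]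
  simp only [map_zero, zero_mul, sub_zero]
  rfl

theorem upperHom_lowerHom {i j : α} (hi : i ∉ K.1) (hj : j ∈ H.1)
    (Q : MvPolynomial (ProperFlat M K.1 H.1) ℝ) :
    upperHom H i (lowerHom (⟨K.1, K.2.1, K.2.2.1, hKH⟩ : ProperFlat M F H.1) j Q)
      = lowerHom K j (upperHom (⟨H.1, H.2.1, hKH, H.2.2.2⟩ : ProperFlat M K.1 G) i Q) := by
  suffices h : (upperHom H i).comp
      (lowerHom (⟨K.1, K.2.1, K.2.2.1, hKH⟩ : ProperFlat M F H.1) j) = (lowerHom K j).comp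
        (upperHom (⟨H.1, H.2.1, hKH, H.2.2.2⟩ : ProperFlat M K.1 G) i) from
    congrArg (fun φ => φ Q) h
  refine MvPolynomial.algHom_ext fun J => ?_
  have hC : ∀ (r : ℝ), upperHom H i (C r) = C r := fun r => (upperHom H i).commutes r
  have hC' : ∀ (r : ℝ), lowerHom K j (C r) = C r := fun r => (lowerHom K j).commutes r
  rw [AlgHom.comp_apply, AlgHom.comp_apply, lowerHom_X, upperHom_X, map_sub, map_mul, map_sub,
    map_mul, lowerHom_X, lowerHom_X, upperHom_X, upperHom_X, hC, hC',
    betaVec_of_mem (H := (⟨H.1, H.2.1, hKH, H.2.2.2⟩ : ProperFlat M K.1 G)) hj,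
    alphaVec_of_notMem (H := (⟨K.1, K.2.1, K.2.2.1, hKH⟩ : ProperFlat M F H.1)) hi]
  simp only [map_zero, zero_mul, sub_zero]
  exact sub_right_comm _ _ _

end Compositions

/-- Both mixed derivatives are the product of lifts of the polynomials of M_F^K, M_K^H and M_H^G.
Using one element of `H \ K` throughout makes the compositions of lifts match exactly. -/
theorem deriv_symm_of_ssubset [M.RankFinite]
    {P : ∀ F G : Set α, MvPolynomial (ProperFlat M F G) ℝ}
    {g : ProperFlat M F G → MvPolynomial (ProperFlat M F G) ℝ}
    (hg : ∀ (H : ProperFlat M F G) (i j : α), i ∈ H.1 \ F → j ∈ G \ H.1 →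
      g H = upperHom H i (P F H.1) * lowerHom H j (P H.1 G))
    (hF : ∀ H : ProperFlat M F G, VolumeAt M P F H.1)
    (hG : ∀ H : ProperFlat M F G, VolumeAt M P H.1 G)
    {H K : ProperFlat M F G} (hKH : K.1 ⊂ H.1) :
    dd (delta K) (g H) = dd (delta H) (g K) := by
  obtain ⟨i, hiH, hiK⟩ := Set.exists_of_ssubset hKH
  obtain ⟨i', hi'⟩ := exists_mem_sdiff_upper K
  obtain ⟨j', hj'⟩ := exists_mem_sdiff_lower H
  have hiF : i ∈ H.1 \ F := ⟨hiH, fun h => hiK (K.2.2.1.subset h)⟩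
  have hiG : i ∈ G \ K.1 := ⟨H.2.2.2.subset hiH, hiK⟩
  set K' : ProperFlat M F H.1 := ⟨K.1, K.2.1, K.2.2.1, hKH⟩
  set H' : ProperFlat M K.1 G := ⟨H.1, H.2.1, hKH, H.2.2.2⟩
  rw [hg H i j' hiF hj', hg K i' i hi' hiG, Derivation.leibniz, Derivation.leibniz, dd_lowerHom,
    dd_lowerHom, dd_upperHom, dd_upperHom,
    upperVec_delta_of_not_subset (H := K) (K := H) hKH.2,
    lowerVec_delta_of_not_subset (H := H) (K := K) hKH.2, dd_zero_apply, dd_zero_apply, map_zero,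
    map_zero, smul_zero, smul_zero, zero_add, add_zero]
  have e1 : upperVec H i (delta K) = delta K' := upperVec_delta_inclUpper H K' i
  have e2 : lowerVec K i (delta H) = delta H' := lowerVec_delta_inclLower K H' i
  rw [e1, e2, (hF H).deriv K' i' i hi' ⟨hiH, hiK⟩, (hG K).deriv H' i j' ⟨hiH, hiK⟩ hj', map_mul,
    map_mul, upperHom_upperHom hKH hiK, lowerHom_lowerHom hKH hiH, upperHom_lowerHom hKH hiK hiH]
  simp only [smul_eq_mul, H', K']
  ring

/-- Both lifts at `H` kill the basis vector of a flat incomparable with `H`. -/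
theorem deriv_eq_zero_of_incomparable
    {P : ∀ F G : Set α, MvPolynomial (ProperFlat M F G) ℝ}
    {g : ProperFlat M F G → MvPolynomial (ProperFlat M F G) ℝ}
    (hg : ∀ (H : ProperFlat M F G) (i j : α), i ∈ H.1 \ F → j ∈ G \ H.1 →
      g H = upperHom H i (P F H.1) * lowerHom H j (P H.1 G))
    {H K : ProperFlat M F G} (h : ¬ K.1 ⊆ H.1) (h' : ¬ H.1 ⊆ K.1) :
    dd (delta K) (g H) = 0 := by
  obtain ⟨i, hi⟩ := exists_mem_sdiff_upper H
  obtain ⟨j, hj⟩ := exists_mem_sdiff_lower H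
  rw [hg H i j hi hj, Derivation.leibniz, dd_lowerHom, dd_upperHom,
    upperVec_delta_of_not_subset h, lowerVec_delta_of_not_subset h', dd_zero_apply, dd_zero_apply,
    map_zero, map_zero, smul_zero, smul_zero, zero_add]

theorem deriv_symm [M.RankFinite]
    {P : ∀ F G : Set α, MvPolynomial (ProperFlat M F G) ℝ}
    {g : ProperFlat M F G → MvPolynomial (ProperFlat M F G) ℝ}
    (hg : ∀ (H : ProperFlat M F G) (i j : α), i ∈ H.1 \ F → j ∈ G \ H.1 →
      g H = upperHom H i (P F H.1) * lowerHom H j (P H.1 G))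
    (hF : ∀ H : ProperFlat M F G, VolumeAt M P F H.1)
    (hG : ∀ H : ProperFlat M F G, VolumeAt M P H.1 G)
    (H K : ProperFlat M F G) : dd (delta K) (g H) = dd (delta H) (g K) := by
  by_cases h : K.1 ⊆ H.1
  · rcases h.eq_or_ssubset with h | h
    · rw [Subtype.ext h]
    · exact deriv_symm_of_ssubset hg hF hG h
  by_cases h' : H.1 ⊆ K.1
  · rcases h'.eq_or_ssubset with h' | h'
    · rw [Subtype.ext h']
    · exact (deriv_symm_of_ssubset hg hF hG h').symm
  rw [deriv_eq_zero_of_incomparable hg h h', deriv_eq_zero_of_incomparable hg h' h]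

theorem invariant_prod {P : ∀ F G : Set α, MvPolynomial (ProperFlat M F G) ℝ}
    {H : ProperFlat M F G} (hF : VolumeAt M P F H.1) (hG : VolumeAt M P H.1 G)
    {i j : α} (hi : i ∈ H.1 \ F) (hj : j ∈ G \ H.1) {w : Vec M F G} (hw : w ∈ W M F G) :
    dd w (upperHom H i (P F H.1) * lowerHom H j (P H.1 G)) = 0 := by
  rw [Derivation.leibniz, dd_lowerHom, dd_upperHom, hF.invariant _ (upperVec_mem_W H hi hw),
    hG.invariant _ (lowerVec_mem_W H hj hw), map_zero, map_zero, smul_zero, smul_zero, zero_add]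

/-- In rank two every element of `G \ F` lies in exactly one proper flat, so each α_i has coordinate
sum 1. -/
theorem sum_eq_zero_of_rank_two [M.Finite] (hF : M.IsFlat F) (hG : M.IsFlat G)
    (hFG : F ⊆ G) (hr : rk M G = rk M F + 2) {w : Vec M F G} (hw : w ∈ W M F G) :
    ∑ H, w H = 0 := by
  classical
  have key : ∀ i ∈ G \ F, ∑ H, alphaVec M F G i H = 1 := by
    intro i hi
    obtain ⟨p, hp, hFp, hip, hpG, hrp, hmin⟩ := exists_cover hF hG hFG hi.1 hi.2
    have hpG' : p ⊂ G := hpG.ssubset_of_ne (by rintro rfl; omega)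
    rw [Finset.sum_eq_single ⟨p, hp, hFp, hpG'⟩]
    · exact alphaVec_of_mem hip
    · intro H _ hne
      refine alphaVec_of_notMem fun hiH => hne ?_
      have h1 := hmin H.1 H.2.1 H.2.2.1.subset hiH
      have h2 := rk_lt_rk H.2.1 hG H.2.2.2
      exact Subtype.ext (eq_of_rk_le hp H.2.1 h1 (by omega)).symm
    · simp
  refine Submodule.span_induction (p := fun w _ => ∑ H, w H = 0) ?_ ?_ ?_ ?_ hw
  · rintro _ ⟨i, hi, j, hj, rfl⟩
    simp [Finset.sum_sub_distrib, key i hi, key j hj]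
  · simp
  · intro x y _ _ hx hy
    simp [Finset.sum_add_distrib, hx, hy]
  · intro c x _ hx
    simp [← Finset.mul_sum, hx]

/-- Euler's formula integrates a symmetric homogeneous gradient. -/
theorem dd_euler_sum {S : Type*} [Fintype S] {n : ℕ} (hn : n ≠ 0)
    (e : S → S → ℝ) (he : ∀ H, dd (e H) = pderiv H) (g : S → MvPolynomial S ℝ)
    (hhom : ∀ H, (g H).IsHomogeneous (n - 1)) (hsymm : ∀ H K, pderiv K (g H) = pderiv H (g K))
    (K : S) : dd (e K) (C (n : ℝ)⁻¹ * ∑ H, X H * g H) = g K := by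
  classical
  have h1 := (hhom K).sum_X_mul_pderiv
  have h2 : pderiv K (∑ H, X H * g H) = n • g K := by
    rw [map_sum]
    have : ∀ H, pderiv K (X H * g H) = X H * pderiv H (g K) + if H = K then g K else 0 := by
      intro H
      rw [pderiv_mul, hsymm, add_comm]
      congr 1
      by_cases h : H = K
      · subst h; simp
      · simp [h, pderiv_X_of_ne h]
    rw [Finset.sum_congr rfl fun H _ => this H, Finset.sum_add_distrib, h1,
      Finset.sum_ite_eq' Finset.univ K, if_pos (Finset.mem_univ K), ← succ_nsmul]
    congr 1
    omega
  rw [he, pderiv_C_mul, h2, nsmul_eq_mul, ← mul_assoc, ← map_natCast (C : ℝ →+* MvPolynomial S ℝ),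
    ← C_mul, inv_mul_cancel₀ (Nat.cast_ne_zero.2 hn), C_1, one_mul]

theorem exists_volumeAt_le [M.Finite] (n : ℕ) :
    ∃ P : ∀ F G : Set α, MvPolynomial (ProperFlat M F G) ℝ,
      ∀ F G, M.IsFlat F → M.IsFlat G → F ⊆ G → rk M G ≤ rk M F + (n + 1) → VolumeAt M P F G := by
  classical
  induction n with
  | zero =>
    refine ⟨fun F G => if rk M G = rk M F + 1 then 1 else 0, fun F G hF hG hFG hr => ?_⟩
    refine ⟨fun h => by simp [h], fun h => by simp [h], ?_, ?_, ?_⟩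
    · have : rk M G - rk M F - 1 = 0 := by omega
      rw [this]
      split_ifs
      · exact isHomogeneous_one _ _
      · exact isHomogeneous_zero _ _ _
    · intro w _
      split_ifs
      · exact Derivation.map_one_eq_zero _
      · exact map_zero _
    · intro H
      have h1 := rk_lt_rk hF H.2.1 H.2.2.1
      have h2 := rk_lt_rk H.2.1 hG H.2.2.2
      omega
  | succ n ih =>
    obtain ⟨P, hP⟩ := ih
    let g : ∀ F G : Set α, ProperFlat M F G → MvPolynomial (ProperFlat M F G) ℝ := fun F G H =>
      upperHom H (exists_mem_sdiff_upper H).choose (P F H.1) *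
        lowerHom H (exists_mem_sdiff_lower H).choose (P H.1 G)
    -- In the new rank the degree is `n + 1`, and Euler's formula dictates the polynomial from its
    -- prescribed partial derivatives `g`.
    let P' : ∀ F G : Set α, MvPolynomial (ProperFlat M F G) ℝ := fun F G =>
      if rk M G ≤ rk M F + (n + 1) then P F G
      else C ((n + 1 : ℕ) : ℝ)⁻¹ * ∑ H, X H * g F G H
    have hP'P : ∀ F G, rk M G ≤ rk M F + (n + 1) → P' F G = P F G := fun F G h => if_pos h
    refine ⟨P', fun F G hF hG hFG hr => ?_⟩
    by_cases hle : rk M G ≤ rk M F + (n + 1)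
    · have h := hP F G hF hG hFG hle
      have e := hP'P F G hle
      refine ⟨by rw [e]; exact h.one, by rw [e]; exact h.zero, by rw [e]; exact h.homogeneous,
        by rw [e]; exact h.invariant, fun H i j hi hj => ?_⟩
      have h1 := rk_lt_rk hF H.2.1 H.2.2.1
      have h2 := rk_lt_rk H.2.1 hG H.2.2.2
      rw [e, hP'P F H.1 (by omega), hP'P H.1 G (by omega)]
      exact h.deriv H i j hi hj
    have hr' : rk M G = rk M F + (n + 2) := by omega
    have hvF : ∀ H : ProperFlat M F G, VolumeAt M P F H.1 := fun H =>
      hP F H.1 hF H.2.1 H.2.2.1.subset (by have := rk_lt_rk H.2.1 hG H.2.2.2; omega)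
    have hvG : ∀ H : ProperFlat M F G, VolumeAt M P H.1 G := fun H =>
      hP H.1 G H.2.1 hG H.2.2.2.subset (by have := rk_lt_rk hF H.2.1 H.2.2.1; omega)
    have hg : ∀ (H : ProperFlat M F G) (i j : α), i ∈ H.1 \ F → j ∈ G \ H.1 →
        g F G H = upperHom H i (P F H.1) * lowerHom H j (P H.1 G) := by
      intro H i j hi hj
      simp only [g]
      rw [upperHom_eq H (exists_mem_sdiff_upper H).choose_spec hi (hvF H).invariant,
        lowerHom_eq H (exists_mem_sdiff_lower H).choose_spec hj (hvG H).invariant]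
    have hhom : ∀ H, (g F G H).IsHomogeneous n := by
      intro H
      have h1 := rk_lt_rk hF H.2.1 H.2.2.1
      have h2 := rk_lt_rk H.2.1 hG H.2.2.2
      have := (isHomogeneous_upperHom H (exists_mem_sdiff_upper H).choose
        (hvF H).homogeneous).mul (isHomogeneous_lowerHom H (exists_mem_sdiff_lower H).choose
        (hvG H).homogeneous)
      convert this using 1
      omega
    have hderiv : ∀ K, dd (delta K) (C ((n + 1 : ℕ) : ℝ)⁻¹ * ∑ H, X H * g F G H) = g F G K := by
      refine dd_euler_sum (Nat.succ_ne_zero n) (fun H => delta H) (fun H => dd_delta H) (g F G)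
        (fun H => by simpa using hhom H) fun H K => ?_
      rw [← dd_delta, ← dd_delta]
      exact deriv_symm hg hvF hvG H K
    have e : P' F G = C ((n + 1 : ℕ) : ℝ)⁻¹ * ∑ H, X H * g F G H := if_neg hle
    have hom' : (P' F G).IsHomogeneous (n + 1) := by
      rw [e]
      have h1 : (∑ H, X H * g F G H).IsHomogeneous (1 + n) :=
        IsHomogeneous.sum _ _ _ fun H _ => (isHomogeneous_X ℝ H).mul (hhom H)
      have := (isHomogeneous_C (ProperFlat M F G) ((n + 1 : ℕ) : ℝ)⁻¹).mul h1
      convert this using 1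
      omega
    refine ⟨fun h => by omega, fun h => by omega, ?_, fun w hw => ?_, fun H i j hi hj => ?_⟩
    · convert hom' using 1
      omega
    -- In degree one the derivative along `w` is a constant, invisible to Euler's formula; it is the
    -- coordinate sum of `w`. In higher degree its partial derivatives vanish by the invariance of
    -- the minors, so it vanishes by Euler's formula.
    · rcases Nat.eq_zero_or_pos n with rfl | hn
      · rw [dd_eq_sum]
        have : ∀ H : ProperFlat M F G, C (w H) * pderiv H (P' F G) = C (w H) := by
          intro H
          have h1 := rk_lt_rk hF H.2.1 H.2.2.1
          have h2 := rk_lt_rk H.2.1 hG H.2.2.2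
          rw [← dd_delta, e, hderiv]
          simp only [g]
          rw [(hvF H).one (by omega), (hvG H).one (by omega), map_one, map_one, mul_one, mul_one]
        rw [Finset.sum_congr rfl fun H _ => this H, ← map_sum,
          sum_eq_zero_of_rank_two hF hG hFG (by omega) hw, map_zero]
      · have h0 : ∀ K : ProperFlat M F G, pderiv K (dd w (P' F G)) = 0 := by
          intro K
          rw [← dd_delta, dd_comm, e, hderiv]
          exact invariant_prod (hvF K) (hvG K) (exists_mem_sdiff_upper K).choose_spec
            (exists_mem_sdiff_lower K).choose_spec hw
        have h1 := (isHomogeneous_dd hom' w).sum_X_mul_pderiv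
        simp only [h0, mul_zero, Finset.sum_const_zero] at h1
        have h2 : n ≠ 0 := by omega
        exact (smul_eq_zero.1 h1.symm).resolve_left (by omega)
    · have h1 := rk_lt_rk hF H.2.1 H.2.2.1
      have h2 := rk_lt_rk H.2.1 hG H.2.2.2
      rw [e, hderiv, hP'P F H.1 (by omega), hP'P H.1 G (by omega)]
      exact hg H i j hi hj

/-- The volume polynomials exist. -/
theorem exists_volumeAt (M : Matroid α) [M.Finite] :
    ∃ P : ∀ F G : Set α, MvPolynomial (ProperFlat M F G) ℝ,
      ∀ F G, M.IsFlat F → M.IsFlat G → F ⊆ G → VolumeAt M P F G := by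
  obtain ⟨P, hP⟩ := exists_volumeAt_le (M := M) (rk M M.E)
  exact ⟨P, fun F G hF hG hFG => hP F G hF hG hFG
    (by have := rk_mono (M := M) hG.subset_ground; omega)⟩

end MatroidVolume

/-! ### Uniqueness of the volume polynomials, and derivatives on the quotient `L`. -/

namespace MatroidVolume
open Matroid MvPolynomial

variable {α : Type*} {M : Matroid α} {F G : Set α}

theorem proj_surjective (M : Matroid α) (F G : Set α) : Function.Surjective (proj M F G) :=
  Submodule.mkQ_surjective _

theorem eRk_eq_add_one_iff [M.RankFinite] :
    M.eRk G = M.eRk F + 1 ↔ rk M G = rk M F + 1 := by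
  rw [← coe_rk, ← coe_rk]
  norm_cast

theorem D_comp_proj (f : L M F G → ℝ) (x p : Vec M F G) :
    D (proj M F G x) f (proj M F G p) = D x (f ∘ proj M F G) p := by
  simp [D, lineDeriv]

theorem hasLineDerivAt_comp_proj {f : L M F G → ℝ} {f' : ℝ} {x p : Vec M F G} :
    HasLineDerivAt ℝ f f' (proj M F G p) (proj M F G x) ↔
      HasLineDerivAt ℝ (f ∘ proj M F G) f' p x := by
  simp [HasLineDerivAt]

theorem isVolume_of_volumeAt [M.Finite] {P : ∀ F G : Set α, MvPolynomial (ProperFlat M F G) ℝ}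
    (hP : ∀ F G, M.IsFlat F → M.IsFlat G → F ⊆ G → VolumeAt M P F G) :
    ∃ V, IsVolume M V := by
  have hV : ∀ F G, M.IsFlat F → M.IsFlat G → F ⊆ G → ∀ t : Vec M F G,
      eval (Function.surjInv (proj_surjective M F G) (proj M F G t)) (P F G) = eval t (P F G) := by
    intro F G hF hG hFG t
    refine eval_eq_of_sub_mem (hP F G hF hG hFG).invariant ?_
    rw [← proj_eq_proj, Function.surjInv_eq (proj_surjective M F G)]
  refine ⟨fun F G x => eval (Function.surjInv (proj_surjective M F G) x) (P F G),
    fun F G hF hG hFG => ⟨fun h t => ?_, fun h => ?_, fun H t => ?_⟩⟩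
  · beta_reduce
    rw [(hP F G hF hG hFG).one (eRk_eq_add_one_iff.1 h), map_one]
  · have h0 := hV F G hF hG hFG 0
    rw [map_zero] at h0
    beta_reduce
    rw [h0]
    rw [Ne, eRk_eq_add_one_iff] at h
    have hle := rk_mono (M := M) hFG
    rcases Nat.lt_or_ge (rk M F) (rk M G) with hlt | hge
    · rw [eval_zero, constantCoeff_eq]
      refine (hP F G hF hG hFG).homogeneous.coeff_eq_zero ?_
      simp
      omega
    · rw [(hP F G hF hG hFG).zero (by omega), map_zero]
  · rw [hasLineDerivAt_comp_proj]
    obtain ⟨i, hi⟩ := exists_mem_sdiff_upper H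
    obtain ⟨j, hj⟩ := exists_mem_sdiff_lower H
    have e : (fun x => eval (Function.surjInv (proj_surjective M F G) x) (P F G)) ∘ proj M F G
        = fun t => eval t (P F G) := funext fun t => hV F G hF hG hFG t
    have h := hasLineDerivAt_eval t (delta H) (P F G)
    rw [(hP F G hF hG hFG).deriv H i j hi hj, map_mul, eval_upperHom, eval_lowerHom,
      ← hV F H.1 hF H.2.1 H.2.2.1.subset, ← hV H.1 G H.2.1 hG H.2.2.2.subset,
      proj_upperVec H hi, proj_lowerVec H hj] at h
    rw [e]
    exact h

/-- The function is constant on lines parallel to the axes, and `t` is reached from 0 one coordinate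
at a time; no joint differentiability is needed. -/
theorem eq_zero_of_hasLineDerivAt_single {S : Type*} [Fintype S] [DecidableEq S]
    {f : (S → ℝ) → ℝ} (h0 : f 0 = 0) (e : S → S → ℝ) (he : ∀ H, e H = Pi.single H 1)
    (h : ∀ H t, HasLineDerivAt ℝ f 0 t (e H)) (t : S → ℝ) : f t = 0 := by
  have hstep : ∀ (H : S) (t : S → ℝ) (c : ℝ), f (t + c • e H) = f t := by
    intro H t c
    have h1 : ∀ s, HasDerivAt (fun s : ℝ => f (t + s • e H)) 0 s := by
      intro s
      have h2 : HasDerivAt (fun r : ℝ => f (t + s • e H + r • e H)) 0 (s - s) := by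
        rw [sub_self]; exact h H (t + s • e H)
      have := h2.comp_sub_const s s
      refine this.congr_of_eventuallyEq (Filter.Eventually.of_forall fun r => ?_)
      simp only [add_assoc, ← add_smul]
      congr 3
      ring
    have := is_const_of_deriv_eq_zero (fun s => (h1 s).differentiableAt)
      (fun s => (h1 s).deriv) c 0
    simpa using this
  have key : ∀ A : Finset S, f (∑ H ∈ A, t H • e H) = 0 := by
    intro A
    induction A using Finset.induction_on with
    | empty => simpa using h0
    | insert H A hH ih => rw [Finset.sum_insert hH, add_comm, hstep, ih]
  have := key Finset.univ
  have hsum : ∑ H, t H • e H = t := by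
    simp only [he]
    ext K
    simp [Finset.sum_apply, Pi.single_apply]
  rwa [hsum] at this

/-- The conditions of `IsVolume` determine the volume polynomials. -/
theorem volume_eq_eval [M.Finite] {P : ∀ F G : Set α, MvPolynomial (ProperFlat M F G) ℝ}
    (hP : ∀ F G, M.IsFlat F → M.IsFlat G → F ⊆ G → VolumeAt M P F G)
    {V : ∀ F G : Set α, L M F G → ℝ} (hV : IsVolume M V) (F G : Set α)
    (hF : M.IsFlat F) (hG : M.IsFlat G) (hFG : F ⊆ G) (t : Vec M F G) :
    V F G (proj M F G t) = eval t (P F G) := by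
  classical
  -- The prescribed derivative along δ_H involves only two minors of smaller rank, so both functions
  -- have the same partial derivatives and the same value at 0.
  induction hn : rk M G - rk M F using Nat.strong_induction_on generalizing F G with
  | _ n ih =>
    obtain ⟨h1, h2, h3⟩ := hV F G hF hG hFG
    by_cases hr : rk M G = rk M F + 1
    · rw [h1 (eRk_eq_add_one_iff.2 hr), (hP F G hF hG hFG).one hr, map_one]
    refine sub_eq_zero.1 (eq_zero_of_hasLineDerivAt_single
      (f := fun t => V F G (proj M F G t) - eval t (P F G)) ?_ (fun H => delta H)
      (fun H => by rw [delta]) (fun H t => ?_) t)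
    · rw [map_zero, h2 (mt eRk_eq_add_one_iff.1 hr), zero_sub, neg_eq_zero]
      have hle := rk_mono (M := M) hFG
      rcases Nat.lt_or_ge (rk M F) (rk M G) with hlt | hge
      · rw [eval_zero, constantCoeff_eq]
        refine (hP F G hF hG hFG).homogeneous.coeff_eq_zero ?_
        simp
        omega
      · rw [(hP F G hF hG hFG).zero (by omega), map_zero]
    · obtain ⟨i, hi⟩ := exists_mem_sdiff_upper H
      obtain ⟨j, hj⟩ := exists_mem_sdiff_lower H
      have a1 := rk_lt_rk hF H.2.1 H.2.2.1
      have a2 := rk_lt_rk H.2.1 hG H.2.2.2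
      have h4 := hasLineDerivAt_comp_proj.1 (h3 H t)
      have h5 := hasLineDerivAt_eval t (delta H) (P F G)
      rw [(hP F G hF hG hFG).deriv H i j hi hj, map_mul, eval_upperHom, eval_lowerHom] at h5
      rw [← proj_upperVec H hi, ← proj_lowerVec H hj,
        ih _ (by omega) F H.1 hF H.2.1 H.2.2.1.subset _ rfl,
        ih _ (by omega) H.1 G H.2.1 hG H.2.2.2.subset _ rfl] at h4
      have := HasDerivAt.sub h4 h5
      rw [sub_self] at this
      exact this

theorem D_eval {S : Type*} (x : S → ℝ) (P : MvPolynomial S ℝ) :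
    D x (fun t => eval t P) = fun t => eval t (dd x P) :=
  funext fun p => (hasLineDerivAt_eval p x P).lineDeriv

theorem D_comp_eval {x : Vec M F G} {f : L M F G → ℝ} {P : MvPolynomial (ProperFlat M F G) ℝ}
    (h : ∀ t, f (proj M F G t) = eval t P) (t : Vec M F G) :
    D (proj M F G x) f (proj M F G t) = eval t (dd x P) := by
  rw [D_comp_proj, show f ∘ proj M F G = fun t => eval t P from funext h, D_eval]

theorem Ds_comp_eval {k : ℕ} {u : Fin k → Vec M F G} {f : L M F G → ℝ}
    {P : MvPolynomial (ProperFlat M F G) ℝ} (h : ∀ t, f (proj M F G t) = eval t P)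
    (t : Vec M F G) :
    Ds (fun i => proj M F G (u i)) f (proj M F G t)
      = eval t (((List.ofFn u).map fun v => ddₗ v).prod P) := by
  have key : ∀ (l : List (Vec M F G)) (t : Vec M F G),
      (l.map (proj M F G)).foldr D f (proj M F G t)
        = eval t ((l.map fun v => ddₗ v).prod P) := by
    intro l
    induction l with
    | nil => intro t; simpa using h t
    | cons v l ih =>
      intro t
      rw [List.map_cons, List.foldr_cons, D_comp_eval ih, List.map_cons, List.prod_cons]
      rfl
  rw [← key, List.map_ofFn]
  rfl

end MatroidVolume

/-! ### Greedy modular functions below a submodular function. -/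

namespace MatroidVolume
open Finset

variable {α : Type*}

section Greedy

open scoped Classical in
/-- The greedy modular function of a set function, for the order given by a key. -/
noncomputable def greedy (E : Finset α) (e : α → ℕ) (c : Set α → ℝ) (i : α) : ℝ :=
  c ↑(insert i {j ∈ E | e j < e i}) - c ↑({j ∈ E | e j < e i} : Finset α)

variable {E : Finset α} {e : α → ℕ} {c : Set α → ℝ}

/-- Over an initial segment of the order the increments telescope. -/
theorem sum_greedy_eq (he : Set.InjOn e E) (h0 : c ∅ = 0) {K : Finset α} (hK : K ⊆ E)
    (hinit : ∀ a ∈ K, ∀ b ∈ E, e b < e a → b ∈ K) : ∑ i ∈ K, greedy E e c i = c K := by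
  classical
  induction K using Finset.induction_on_max_value e with
  | empty => simpa using h0.symm
  | insert m s hm hmax ih =>
    have hmE : m ∈ E := hK (mem_insert_self m s)
    have hs : s = {j ∈ E | e j < e m} := by
      ext j
      rw [mem_filter]
      constructor
      · intro hj
        have hjE := hK (mem_insert_of_mem hj)
        exact ⟨hjE, (hmax j hj).lt_of_ne fun h => hm (he hjE hmE h ▸ hj)⟩
      · rintro ⟨hjE, hj⟩
        refine (mem_insert.1 (hinit m (mem_insert_self m s) j hjE hj)).resolve_left ?_
        rintro rfl
        exact lt_irrefl _ hj
    rw [sum_insert hm, ih ((subset_insert m s).trans hK), greedy, ← hs]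
    · simp
    · intro a ha b hb hba
      refine (mem_insert.1 (hinit a (mem_insert_of_mem ha) b hb hba)).resolve_left ?_
      rintro rfl
      exact absurd hba (not_lt.2 (hmax a ha))

/-- Edmonds' greedy argument: submodularity for `K`, with last element `m`, and the set `B` of all
predecessors of `m` shows that adding `m` within `K` costs at least the greedy increment, and
strictly more if `K` misses a predecessor. -/
theorem sum_greedy_le (he : Set.InjOn e E) (h0 : c ∅ = 0)
    (hc : ∀ I J : Set α, I ⊆ E → J ⊆ E → ¬ I ⊆ J → ¬ J ⊆ I → c (I ∩ J) + c (I ∪ J) < c I + c J)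
    {K : Finset α} (hK : K ⊆ E) :
    ∑ i ∈ K, greedy E e c i ≤ c K ∧
      ((∃ a ∈ K, ∃ b ∈ E, b ∉ K ∧ e b < e a) → ∑ i ∈ K, greedy E e c i < c K) := by
  classical
  induction K using Finset.induction_on_max_value e with
  | empty => simp [h0]
  | insert m s hm hmax ih =>
    have hmE : m ∈ E := hK (mem_insert_self m s)
    have ih := (ih ((subset_insert m s).trans hK)).1
    set B : Finset α := {j ∈ E | e j < e m} with hB
    have hsB : s ⊆ B := fun j hj => by
      have hjE := hK (mem_insert_of_mem hj)
      exact mem_filter.2 ⟨hjE, (hmax j hj).lt_of_ne fun h => hm (he hjE hmE h ▸ hj)⟩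
    have hmB : m ∉ B := fun h => lt_irrefl _ (mem_filter.1 h).2
    have e1 : insert m s ∩ B = s := by
      rw [insert_inter_of_notMem hmB, inter_eq_left.2 hsB]
    have e2 : insert m s ∪ B = insert m B := by
      rw [insert_union, union_eq_right.2 hsB]
    have hIJ : ¬ insert m s ⊆ B := fun h => hmB (h (mem_insert_self m s))
    have hsum : ∑ i ∈ insert m s, greedy E e c i
        = c ↑(insert m B) - c ↑B + ∑ i ∈ s, greedy E e c i := by
      rw [sum_insert hm, greedy]
    have key : ¬ B ⊆ insert m s →
        ∑ i ∈ insert m s, greedy E e c i < c ↑(insert m s) := by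
      intro hJI
      have := hc ↑(insert m s) ↑B (by exact_mod_cast hK)
        (by exact_mod_cast filter_subset _ _) (by exact_mod_cast hIJ) (by exact_mod_cast hJI)
      rw [← coe_inter, ← coe_union, e1, e2] at this
      linarith
    constructor
    · by_cases hJI : B ⊆ insert m s
      · have : s = B := Subset.antisymm hsB fun j hj =>
          (mem_insert.1 (hJI hj)).resolve_left (by rintro rfl; exact hmB hj)
        rw [hsum, ← this]
        linarith
      · exact (key hJI).le
    · rintro ⟨a, ha, b, hbE, hb, hba⟩
      refine key fun h => hb (h (mem_filter.2 ⟨hbE, hba.trans_le ?_⟩))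
      rcases mem_insert.1 ha with rfl | ha
      · exact le_rfl
      · exact hmax a ha

end Greedy

/-! ### Orders refining a chain of sets. -/

section Chains

variable {τ : Finset (Set α)} {E K : Set α}

theorem exists_bot (hne : τ.Nonempty) (hc : ∀ H ∈ τ, ∀ K ∈ τ, H ⊆ K ∨ K ⊆ H) :
    ∃ H ∈ τ, ∀ K ∈ τ, H ⊆ K := by
  obtain ⟨H, hH⟩ := τ.exists_minimal hne
  refine ⟨H, hH.1, fun K hK => ?_⟩
  rcases hc H hH.1 K hK with h | h
  · exact h
  · exact hH.2 hK h

theorem exists_mem_forall_notMem (hc : ∀ H ∈ τ, ∀ K ∈ τ, H ⊆ K ∨ K ⊆ H) (hK : K.Nonempty) :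
    ∃ a ∈ K, ∀ H ∈ τ, H ⊂ K → a ∉ H := by
  classical
  rcases (τ.filter (· ⊂ K)).eq_empty_or_nonempty with h | h
  · obtain ⟨a, ha⟩ := hK
    exact ⟨a, ha, fun H hH hHK => absurd (mem_filter.2 ⟨hH, hHK⟩) (by rw [h]; simp)⟩
  · obtain ⟨F, hF, hmax⟩ := exists_top h fun H hH L hL =>
      hc H (mem_filter.1 hH).1 L (mem_filter.1 hL).1
    obtain ⟨a, haK, haF⟩ := Set.exists_of_ssubset (mem_filter.1 hF).2
    exact ⟨a, haK, fun H hH hHK haH => haF (hmax H (mem_filter.2 ⟨hH, hHK⟩) haH)⟩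

theorem exists_notMem_forall_mem (hc : ∀ H ∈ τ, ∀ K ∈ τ, H ⊆ K ∨ K ⊆ H) (hτE : ∀ H ∈ τ, H ⊆ E)
    (hK : K ⊂ E) : ∃ b ∈ E, b ∉ K ∧ ∀ H ∈ τ, K ⊂ H → b ∈ H := by
  classical
  rcases (τ.filter (K ⊂ ·)).eq_empty_or_nonempty with h | h
  · obtain ⟨b, hb, hbK⟩ := Set.exists_of_ssubset hK
    exact ⟨b, hb, hbK, fun H hH hHK => absurd (mem_filter.2 ⟨hH, hHK⟩) (by rw [h]; simp)⟩
  · obtain ⟨G, hG, hmin⟩ := exists_bot h fun H hH L hL =>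
      hc H (mem_filter.1 hH).1 L (mem_filter.1 hL).1
    obtain ⟨b, hbG, hbK⟩ := Set.exists_of_ssubset (mem_filter.1 hG).2
    exact ⟨b, hτE G (mem_filter.1 hG).1 hbG, hbK,
      fun H hH hHK => hmin H (mem_filter.2 ⟨hH, hHK⟩) hbG⟩

open scoped Classical in
/-- The number of members of a chain that miss a given element. -/
noncomputable def level (τ : Finset (Set α)) (i : α) : ℕ := (τ.filter fun H => i ∉ H).card

/-- Members of the chain are closed under lowering the level, so they are initial segments of any
order refining it. -/
theorem mem_of_level_le (hc : ∀ H ∈ τ, ∀ K ∈ τ, H ⊆ K ∨ K ⊆ H) {H : Set α} (hH : H ∈ τ) {a b : α}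
    (ha : a ∈ H) (hab : level τ b ≤ level τ a) : b ∈ H := by
  classical
  by_contra hb
  refine absurd hab (not_le.2 (card_lt_card ?_))
  refine (ssubset_iff_of_subset fun K hK => ?_).2 ⟨H, mem_filter.2 ⟨hH, hb⟩, by simp [ha]⟩
  obtain ⟨hKτ, haK⟩ := mem_filter.1 hK
  refine mem_filter.2 ⟨hKτ, fun hbK => ?_⟩
  rcases hc H hH K hKτ with h | h
  · exact haK (h ha)
  · exact hb (h hbK)

/-- Take `a` in `K` outside all smaller members and `b` outside `K` inside all larger ones; each
member then contains both or neither. -/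
theorem exists_level_eq (hc : ∀ H ∈ τ, ∀ K ∈ τ, H ⊆ K ∨ K ⊆ H) (hτE : ∀ H ∈ τ, H ⊆ E)
    (hKτ : K ∉ τ) (hcK : ∀ H ∈ τ, H ⊆ K ∨ K ⊆ H) (hK : K.Nonempty) (hKE : K ⊂ E) :
    ∃ a ∈ K, ∃ b ∈ E, b ∉ K ∧ level τ a = level τ b := by
  classical
  obtain ⟨a, ha, ha'⟩ := exists_mem_forall_notMem hc hK
  obtain ⟨b, hb, hbK, hb'⟩ := exists_notMem_forall_mem hc hτE hKE
  refine ⟨a, ha, b, hb, hbK, congrArg card (filter_congr fun H hH => ?_)⟩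
  have hne : H ≠ K := by rintro rfl; exact hKτ hH
  rcases hcK H hH with h | h
  · exact iff_of_true (ha' H hH (h.ssubset_of_ne hne)) fun h' => hbK (h h')
  · exact not_iff_not.2 (iff_of_true (h ha) (hb' H hH (h.ssubset_of_ne hne.symm)))

theorem exists_keys (E : Finset α) (h : α → ℕ) :
    ∃ e₁ e₂ : α → ℕ, Set.InjOn e₁ E ∧ Set.InjOn e₂ E ∧
      (∀ i ∈ E, ∀ j ∈ E, h i < h j → e₁ i < e₁ j) ∧ (∀ i ∈ E, ∀ j ∈ E, h i < h j → e₂ i < e₂ j) ∧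
      ∀ i ∈ E, ∀ j ∈ E, i ≠ j → h i = h j → e₁ i < e₁ j ∨ e₂ i < e₂ j := by
  classical
  obtain ⟨e, N, he, hN⟩ : ∃ (e : α → ℕ) (N : ℕ), Set.InjOn e E ∧ ∀ i ∈ E, e i < N := by
    refine ⟨fun i => if hi : i ∈ E then E.equivFin ⟨i, hi⟩ else 0, E.card, ?_, ?_⟩
    · intro i hi j hj hij
      have hi : i ∈ E := hi
      have hj : j ∈ E := hj
      simp only [hi, hj, dif_pos] at hij
      simpa using E.equivFin.injective (Fin.ext hij)
    · intro i hi
      simp [hi]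
  have hlt : ∀ (x y : ℕ) (r s : ℕ), r < N → x < y → x * N + r < y * N + s := by
    intro x y r s hr hxy
    have : (x + 1) * N ≤ y * N := Nat.mul_le_mul_right N hxy
    linarith [add_one_mul x N]
  have hinj : ∀ r : α → ℕ, (∀ i ∈ E, r i < N) → Set.InjOn r E →
      Set.InjOn (fun i => h i * N + r i) E := by
    intro r hr hrinj i hi j hj hij
    rcases lt_trichotomy (h i) (h j) with hl | hl | hl
    · exact absurd hij (hlt _ _ _ _ (hr i hi) hl).ne
    · refine hrinj hi hj ?_
      simpa [hl] using hij
    · exact absurd hij (hlt _ _ _ _ (hr j hj) hl).ne'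
  -- The value of `h` is the leading digit in base `N`; an enumeration and its reverse break ties in
  -- opposite ways.
  refine ⟨fun i => h i * N + e i, fun i => h i * N + (N - 1 - e i), hinj e hN he,
    hinj _ (fun i hi => ?_) (fun i hi j hj hij => ?_),
    fun i hi j hj hij => hlt _ _ _ _ (hN i hi) hij,
    fun i hi j hj hij => hlt _ _ _ _ (by have := hN i hi; omega) hij, ?_⟩
  · have := hN i hi; omega
  · have h1 := hN i hi
    have h2 := hN j hj
    exact he hi hj (by omega)
  · intro i hi j hj hne hij
    have h1 := hN i hi
    have h2 := hN j hj
    have h3 : e i ≠ e j := fun h => hne (he hi hj h)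
    simp only [hij]
    omega

end Chains

/-- A set function agrees with a modular one along a chain, and a strictly submodular function
exceeds it at the other sets that are comparable with the chain. -/
theorem exists_modular {E : Finset α} {τ : Finset (Set α)}
    (hc : ∀ H ∈ τ, ∀ K ∈ τ, H ⊆ K ∨ K ⊆ H) (hτE : ∀ H ∈ τ, H ⊆ E) (c : Set α → ℝ) (h0 : c ∅ = 0) :
    ∃ a : α → ℝ, (∑ i ∈ E, a i = c E) ∧
      (∀ K : Finset α, ↑K ∈ τ → ∑ i ∈ K, a i = c K) ∧
      ((∀ I J : Set α, I ⊆ E → J ⊆ E → ¬ I ⊆ J → ¬ J ⊆ I → c (I ∩ J) + c (I ∪ J) < c I + c J) →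
        ∀ K : Finset α, K ⊂ E → K.Nonempty → ↑K ∉ τ → (∀ H ∈ τ, H ⊆ K ∨ ↑K ⊆ H) →
          ∑ i ∈ K, a i < c K) := by
  classical
  obtain ⟨e₁, e₂, hi₁, hi₂, hl₁, hl₂, hor⟩ := exists_keys E (level τ)
  have hsum : ∀ K : Finset α, ∑ i ∈ K, (greedy E e₁ c i + greedy E e₂ c i) / 2
      = (∑ i ∈ K, greedy E e₁ c i + ∑ i ∈ K, greedy E e₂ c i) / 2 := fun K => by
    rw [← sum_div, sum_add_distrib]
  have hinit : ∀ e : α → ℕ, (∀ i ∈ E, ∀ j ∈ E, level τ i < level τ j → e i < e j) →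
      ∀ K : Finset α, ↑K ∈ τ → ∀ a ∈ K, ∀ b ∈ E, e b < e a → b ∈ K := by
    intro e he K hK a ha b hb hba
    have haE : a ∈ E := hτE _ hK ha
    refine mem_coe.1 (mem_of_level_le hc hK (mem_coe.2 ha) (not_lt.1 fun h => ?_))
    exact lt_asymm hba (he a haE b hb h)
  -- Members of the chain are initial segments for both orders, so the average agrees with `c`
  -- there. Any other comparable `K` separates two elements of equal level, and one of the orders
  -- puts the outside element first, making its inequality strict.
  refine ⟨fun i => (greedy E e₁ c i + greedy E e₂ c i) / 2, ?_, fun K hK => ?_,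
    fun hsub K hKE hne hKτ hcK => ?_⟩
  · rw [hsum, sum_greedy_eq hi₁ h0 subset_rfl fun _ _ b hb _ => hb,
      sum_greedy_eq hi₂ h0 subset_rfl fun _ _ b hb _ => hb, add_self_div_two]
  · have hKE : K ⊆ E := by exact_mod_cast hτE _ hK
    rw [hsum, sum_greedy_eq hi₁ h0 hKE (hinit e₁ hl₁ K hK),
      sum_greedy_eq hi₂ h0 hKE (hinit e₂ hl₂ K hK), add_self_div_two]
  · obtain ⟨a, ha, b, hb, hbK, hab⟩ := exists_level_eq (E := ↑E) hc hτE hKτ hcK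
      (by exact_mod_cast hne) (by exact_mod_cast hKE)
    obtain ⟨h1, h1'⟩ := sum_greedy_le hi₁ h0 hsub hKE.subset
    obtain ⟨h2, h2'⟩ := sum_greedy_le hi₂ h0 hsub hKE.subset
    rw [hsum]
    have haK : a ∈ K := ha
    have hbK' : b ∉ K := hbK
    rcases hor b hb a (hKE.subset haK) (by rintro rfl; exact hbK ha) hab.symm with h | h
    · have := h1' ⟨a, haK, b, hb, hbK', h⟩
      linarith
    · have := h2' ⟨a, haK, b, hb, hbK', h⟩
      linarith

end MatroidVolume

/-! ### Flags of flats and their links. -/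

namespace MatroidVolume
open Matroid Finset

variable {α : Type*} {M : Matroid α} {F G : Set α}

/-- A flag of proper flats. -/
def IsFlag (τ : Finset (ProperFlat M F G)) : Prop :=
  ∀ H ∈ τ, ∀ K ∈ τ, H.1 ⊆ K.1 ∨ K.1 ⊆ H.1

/-- The underlying sets of a family of proper flats. -/
def carriers (τ : Finset (ProperFlat M F G)) : Finset (Set α) :=
  τ.map (Function.Embedding.subtype _)

theorem mem_carriers {τ : Finset (ProperFlat M F G)} {H : Set α} :
    H ∈ carriers τ ↔ ∃ K ∈ τ, K.1 = H := by
  simp [carriers]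

theorem coe_mem_carriers {τ : Finset (ProperFlat M F G)} {H : ProperFlat M F G} :
    H.1 ∈ carriers τ ↔ H ∈ τ :=
  Finset.mem_map' (Function.Embedding.subtype _)

theorem card_carriers (τ : Finset (ProperFlat M F G)) : (carriers τ).card = τ.card := card_map _

theorem IsFlag.carriers {τ : Finset (ProperFlat M F G)} (hτ : IsFlag τ) :
    ∀ H ∈ carriers τ, ∀ K ∈ carriers τ, H ⊆ K ∨ K ⊆ H := by
  intro H' hH' K' hK'
  obtain ⟨H, hH, rfl⟩ := mem_carriers.1 hH'
  obtain ⟨K, hK, rfl⟩ := mem_carriers.1 hK'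
  exact hτ H hH K hK

theorem IsFlag.card_lt [M.RankFinite] {τ : Finset (ProperFlat M F G)} (hτ : IsFlag τ)
    (hF : M.IsFlat F) (hG : M.IsFlat G) (hFG : F ⊂ G) : τ.card + 1 + rk M F ≤ rk M G := by
  rw [← card_carriers]
  refine chain_card_lt hF hG hFG (fun H hH => ?_) hτ.carriers
  obtain ⟨H, hH, rfl⟩ := mem_carriers.1 hH
  exact H.2

theorem IsFlag.exists_gap [M.RankFinite] {τ : Finset (ProperFlat M F G)} (hτ : IsFlag τ)
    (hF : M.IsFlat F) (hG : M.IsFlat G) (hFG : F ⊂ G) (hcard : τ.card + 1 + rk M F < rk M G) :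
    ∃ F' G', M.IsFlat F' ∧ M.IsFlat G' ∧ F ⊆ F' ∧ F' ⊂ G' ∧ G' ⊆ G ∧ rk M F' + 2 ≤ rk M G' ∧
      (∀ H ∈ τ, H.1 ⊆ F' ∨ G' ⊆ H.1) ∧ (F' = F ∨ ∃ H ∈ τ, H.1 = F') ∧
      (G' = G ∨ ∃ H ∈ τ, H.1 = G') := by
  rw [← card_carriers] at hcard
  obtain ⟨F', G', h1, h2, h3, h4, h5, h6, h7, h8, h9⟩ :=
    MatroidVolume.exists_gap hF hG hFG (σ := MatroidVolume.carriers τ) (fun H hH => by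
      obtain ⟨H, hH, rfl⟩ := mem_carriers.1 hH
      exact H.2) hτ.carriers hcard
  exact ⟨F', G', h1, h2, h3, h4, h5, h6, fun H hH => h7 _ (coe_mem_carriers.2 hH),
    h8.imp_right mem_carriers.1, h9.imp_right mem_carriers.1⟩

section Link

variable [M.Finite]

open scoped Classical in
/-- The proper flats outside a flag that are comparable with all its members. -/
noncomputable def link (τ : Finset (ProperFlat M F G)) : Finset (ProperFlat M F G) :=
  univ.filter fun K => K ∉ τ ∧ ∀ H ∈ τ, H.1 ⊆ K.1 ∨ K.1 ⊆ H.1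

theorem mem_link {τ : Finset (ProperFlat M F G)} {K : ProperFlat M F G} :
    K ∈ link τ ↔ K ∉ τ ∧ ∀ H ∈ τ, H.1 ⊆ K.1 ∨ K.1 ⊆ H.1 := by
  simp [link]

theorem IsFlag.insert [DecidableEq (ProperFlat M F G)] {τ : Finset (ProperFlat M F G)}
    (hτ : IsFlag τ) {K : ProperFlat M F G} (hK : K ∈ link τ) : IsFlag (insert K τ) := by
  have hK := (mem_link.1 hK).2
  intro H hH' L hL'
  rcases mem_insert.1 hH' with rfl | hH <;> rcases mem_insert.1 hL' with rfl | hL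
  · exact Or.inl subset_rfl
  · exact (hK L hL).symm
  · exact hK H hH
  · exact hτ H hH L hL

theorem mem_link_insert [DecidableEq (ProperFlat M F G)] {τ : Finset (ProperFlat M F G)}
    {K L : ProperFlat M F G} (hL : L ∈ link τ) (hne : K ≠ L) (h : K.1 ⊆ L.1 ∨ L.1 ⊆ K.1) :
    L ∈ link (insert K τ) := by
  obtain ⟨h1, h2⟩ := mem_link.1 hL
  refine mem_link.2 ⟨fun hm => (mem_insert.1 hm).elim (fun e => hne e.symm) h1, fun H hH => ?_⟩
  rcases mem_insert.1 hH with rfl | hH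
  · exact h
  · exact h2 H hH

/-- A flat covering the bottom of a gap, inside that gap, is comparable with the whole flag. -/
theorem IsFlag.link_nonempty {τ : Finset (ProperFlat M F G)} (hτ : IsFlag τ)
    (hF : M.IsFlat F) (hG : M.IsFlat G) (hFG : F ⊂ G) (hcard : τ.card + 1 + rk M F < rk M G) :
    (link τ).Nonempty := by
  obtain ⟨F', G', h1, h2, h3, h4, h5, h6, h7, -, -⟩ := hτ.exists_gap hF hG hFG hcard
  obtain ⟨e, heG, heF⟩ := Set.exists_of_ssubset h4
  obtain ⟨p, hp, hFp, -, hpG, hrp, -⟩ := exists_cover h1 h2 h4.subset heG heF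
  have hpG' : p ⊂ G' := hpG.ssubset_of_ne (by rintro rfl; omega)
  refine ⟨⟨p, hp, h3.trans_ssubset hFp, hpG'.trans_subset h5⟩, mem_link.2 ⟨fun hm => ?_,
    fun H hH => ?_⟩⟩
  · rcases h7 _ hm with h | h
    · exact hFp.not_subset h
    · exact hpG'.not_subset h
  · rcases h7 H hH with h | h
    · exact Or.inl (h.trans hFp.subset)
    · exact Or.inr (hpG.trans h)

/-- The links of flags of codimension at least three are connected. -/
theorem IsFlag.link_connected {τ : Finset (ProperFlat M F G)} (hτ : IsFlag τ)
    (hF : M.IsFlat F) (hG : M.IsFlat G) (hFG : F ⊂ G) (hcard : τ.card + 2 + rk M F < rk M G)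
    {f : ProperFlat M F G → ℝ}
    (hf : ∀ K ∈ link τ, ∀ L ∈ link τ, K.1 ⊆ L.1 → f K = f L)
    {K₁ K₂ : ProperFlat M F G} (h₁ : K₁ ∈ link τ) (h₂ : K₂ ∈ link τ) : f K₁ = f K₂ := by
  classical
  by_cases h12 : K₁.1 ⊆ K₂.1
  · exact hf _ h₁ _ h₂ h12
  by_cases h21 : K₂.1 ⊆ K₁.1
  · exact (hf _ h₂ _ h₁ h21).symm
  -- Incomparable members of the link lie in the same gap of the flag; `F'` is its bottom. Each is
  -- then joined to a flat covering `F'`.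
  obtain ⟨F', hF', hFF', hF'1, hF'2, hF'τ, hsplit⟩ : ∃ F', M.IsFlat F' ∧ F ⊆ F' ∧ F' ⊂ K₁.1 ∧
      F' ⊂ K₂.1 ∧ (F' = F ∨ ∃ H ∈ τ, H.1 = F') ∧
      ∀ H ∈ τ, H.1 ⊆ F' ∨ (K₁.1 ⊆ H.1 ∧ K₂.1 ⊆ H.1) := by
    have hl : ∀ H ∈ τ, H.1 ⊂ K₁.1 → H.1 ⊂ K₂.1 := by
      intro H hH hHK
      rcases (mem_link.1 h₂).2 H hH with h | h
      · exact h.ssubset_of_ne fun e => h21 (e ▸ hHK.subset)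
      · exact absurd (h.trans hHK.subset) h21
    have hu : ∀ H ∈ τ, ¬ H.1 ⊂ K₁.1 → K₁.1 ⊆ H.1 ∧ K₂.1 ⊆ H.1 := by
      intro H hH hHK
      have h3 : K₁.1 ⊆ H.1 := by
        rcases (mem_link.1 h₁).2 H hH with h | h
        · by_contra h'
          exact hHK ⟨h, h'⟩
        · exact h
      refine ⟨h3, ?_⟩
      rcases (mem_link.1 h₂).2 H hH with h | h
      · exact absurd (h3.trans h) h12
      · exact h
    rcases (τ.filter fun H => H.1 ⊂ K₁.1).eq_empty_or_nonempty with he | hne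
    · refine ⟨F, hF, subset_rfl, K₁.2.2.1, K₂.2.2.1, Or.inl rfl, fun H hH => Or.inr (hu H hH ?_)⟩
      exact fun h => (filter_eq_empty_iff.1 he) hH h
    · obtain ⟨H', hH', hmax⟩ := exists_top
        (σ := MatroidVolume.carriers (τ.filter fun H => H.1 ⊂ K₁.1))
        (by simpa [MatroidVolume.carriers] using hne)
        (IsFlag.carriers fun H hH L hL => hτ H (mem_filter.1 hH).1 L (mem_filter.1 hL).1)
      obtain ⟨H, hH, rfl⟩ := mem_carriers.1 hH'
      obtain ⟨hHτ, hHK⟩ := mem_filter.1 hH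
      refine ⟨H.1, H.2.1, H.2.2.1.subset, hHK, hl H hHτ hHK, Or.inr ⟨H, hHτ, rfl⟩, fun L hL => ?_⟩
      by_cases hLK : L.1 ⊂ K₁.1
      · exact Or.inl (hmax L.1 (coe_mem_carriers.2 (mem_filter.2 ⟨hL, hLK⟩)))
      · exact Or.inr (hu L hL hLK)
  obtain ⟨e₁, he₁, he₁'⟩ := Set.exists_of_ssubset hF'1
  obtain ⟨e₂, he₂, he₂'⟩ := Set.exists_of_ssubset hF'2
  obtain ⟨p₁, hp₁, hFp₁, -, hpK₁, hr₁, hmin₁⟩ := exists_cover hF' K₁.2.1 hF'1.subset he₁ he₁'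
  obtain ⟨p₂, hp₂, hFp₂, hep₂, hpK₂, hr₂, hmin₂⟩ := exists_cover hF' K₂.2.1 hF'2.subset he₂ he₂'
  set P₁ : ProperFlat M F G :=
    ⟨p₁, hp₁, hFF'.trans_ssubset hFp₁, hpK₁.trans_ssubset K₁.2.2.2⟩ with hP₁
  set P₂ : ProperFlat M F G :=
    ⟨p₂, hp₂, hFF'.trans_ssubset hFp₂, hpK₂.trans_ssubset K₂.2.2.2⟩ with hP₂
  have hP₁l : P₁ ∈ link τ := by
    refine mem_link.2 ⟨fun hm => ?_, fun H hH => ?_⟩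
    · rcases hsplit _ hm with h | h
      · exact hFp₁.not_subset h
      · exact h21 (h.2.trans hpK₁)
    · exact (hsplit H hH).imp (fun h => h.trans hFp₁.subset) fun h => hpK₁.trans h.1
  have hP₂l : P₂ ∈ link τ := by
    refine mem_link.2 ⟨fun hm => ?_, fun H hH => ?_⟩
    · rcases hsplit _ hm with h | h
      · exact hFp₂.not_subset h
      · exact h12 (h.1.trans hpK₂)
    · exact (hsplit H hH).imp (fun h => h.trans hFp₂.subset) fun h => hpK₂.trans h.2
  rw [← hf P₁ hP₁l K₁ h₁ hpK₁, ← hf P₂ hP₂l K₂ h₂ hpK₂]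
  by_cases he : e₂ ∈ p₁
  · have h := eq_of_rk_le hp₂ hp₁ (hmin₂ p₁ hp₁ hFp₁.subset he) (by omega)
    exact congrArg f (Subtype.ext h.symm)
  obtain ⟨q, hq, hpq, heq, hqG, hrq, hminq⟩ := exists_cover hp₁ hG P₁.2.2.2.subset
    (K₂.2.2.2.subset he₂) he
  have hp₂q : p₂ ⊆ q := hmin₂ q hq (hFp₁.subset.trans hpq.subset) heq
  -- The join `q` of `p₁` and `p₂` is a common neighbour when it belongs to the link. Otherwise the
  -- gap has rank two, but another flat is still missing from the flag, so `P₁` has a neighbour `K₃`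
  -- in the link. No flat lies strictly between `F'` and `p₁` or between `p₁` and `q`, so `K₃`
  -- contains `q` or lies in `F'`, and is comparable with `P₂` too.
  by_cases hqτ : q ∈ MatroidVolume.carriers τ ∨ q = G
  · have hP₁τ := (mem_link.1 hP₁l).1
    obtain ⟨K₃, hK₃⟩ := (hτ.insert hP₁l).link_nonempty hF hG hFG
      (by rw [card_insert_of_notMem hP₁τ]; omega)
    obtain ⟨hK₃1, hK₃2⟩ := mem_link.1 hK₃
    have hne : K₃ ≠ P₁ := fun h => hK₃1 (h ▸ mem_insert_self _ _)
    have hK₃τ : K₃ ∉ τ := fun h => hK₃1 (mem_insert_of_mem h)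
    have hK₃l : K₃ ∈ link τ := mem_link.2 ⟨hK₃τ, fun H hH => hK₃2 H (mem_insert_of_mem hH)⟩
    rcases hK₃2 P₁ (mem_insert_self _ _) with h | h
    · have hqK : q ⊆ K₃.1 := by
        by_contra hnot
        have hKq : K₃.1 ⊆ q := by
          rcases hqτ with hqτ | rfl
          · obtain ⟨Q, hQ, rfl⟩ := mem_carriers.1 hqτ
            exact (hK₃2 Q (mem_insert_of_mem hQ)).resolve_left hnot
          · exact K₃.2.2.2.subset
        have hlt := rk_lt_rk K₃.2.1 hq ⟨hKq, hnot⟩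
        have := eq_of_rk_le hp₁ K₃.2.1 h (by omega)
        exact hne (Subtype.ext this.symm)
      rw [hf P₁ hP₁l K₃ hK₃l h, hf P₂ hP₂l K₃ hK₃l (hp₂q.trans hqK)]
    · have hKF : K₃.1 ⊆ F' := by
        by_contra hnot
        have hFK : F' ⊆ K₃.1 := by
          rcases hF'τ with rfl | ⟨H, hH, rfl⟩
          · exact K₃.2.2.1.subset
          · exact (hK₃2 H (mem_insert_of_mem hH)).resolve_right hnot
        have hlt := rk_lt_rk hF' K₃.2.1 ⟨hFK, hnot⟩
        have := eq_of_rk_le K₃.2.1 hp₁ h (by omega)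
        exact hne (Subtype.ext this)
      rw [← hf K₃ hK₃l P₁ hP₁l h, ← hf K₃ hK₃l P₂ hP₂l (hKF.trans hFp₂.subset)]
  · push Not at hqτ
    have hql : (⟨q, hq, hFF'.trans_ssubset (hFp₁.trans hpq), hqG.ssubset_of_ne hqτ.2⟩ :
        ProperFlat M F G) ∈ link τ := by
      refine mem_link.2 ⟨fun hm => hqτ.1 (coe_mem_carriers.2 hm), fun H hH => ?_⟩
      rcases hsplit H hH with h | h
      · exact Or.inl (h.trans (hFp₁.trans hpq).subset)
      · exact Or.inr (hminq H.1 H.2.1 (hpK₁.trans h.1) (h.2 he₂))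
    rw [hf P₁ hP₁l _ hql hpq.subset, hf P₂ hP₂l _ hql hp₂q]

end Link

end MatroidVolume

/-! ### Representatives of ample classes adapted to a flag. -/

namespace MatroidVolume
open Matroid Finset

variable {α : Type*} {M : Matroid α}

theorem ground_ssubset {d : ℕ} (hr : rk M M.E = d + 1) : (∅ : Set α) ⊂ M.E :=
  (Set.empty_subset _).ssubset_of_ne fun h => by rw [← h, rk_empty] at hr; omega

section Representatives

/-- This makes a set function matter only up to modular functions of total zero. -/
theorem modular_mem_W {E : Finset α} (hE : (E : Set α) = M.E) {a : α → ℝ}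
    (ha : ∑ i ∈ E, a i = 0) : (∑ i ∈ E, a i • alphaVec M ∅ M.E i) ∈ W M ∅ M.E := by
  rcases E.eq_empty_or_nonempty with rfl | ⟨i₀, hi₀⟩
  · simp
  have hmem : ∀ i ∈ E, i ∈ M.E \ ∅ := fun i hi => ⟨hE ▸ mem_coe.2 hi, Set.notMem_empty i⟩
  have : ∑ i ∈ E, a i • alphaVec M ∅ M.E i
      = ∑ i ∈ E, a i • (alphaVec M ∅ M.E i - alphaVec M ∅ M.E i₀) := by
    simp only [smul_sub, sum_sub_distrib]
    rw [← sum_smul, ha, zero_smul, sub_zero]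
  rw [this]
  exact Submodule.sum_mem _ fun i hi =>
    Submodule.smul_mem _ _ (alphaVec_sub_mem (hmem i hi) (hmem i₀ hi₀))

variable [M.Finite]

/-- Subtract the modular function of `exists_modular`: it has total `c M.E = 0`, agrees with `c` on
the flag and is smaller on the link. Ampleness enters the argument only through this positivity. -/
theorem exists_representative {τ : Finset (ProperFlat M ∅ M.E)} (hτ : IsFlag τ) (c : Set α → ℝ)
    (h0 : c ∅ = 0) (h1 : c M.E = 0) :
    ∃ t : Vec M ∅ M.E, (fun H => c H.1) - t ∈ W M ∅ M.E ∧ (∀ H ∈ τ, t H = 0) ∧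
      (StrictlySubmodular M.E c → ∀ K ∈ link τ, 0 < t K) := by
  classical
  set E := M.ground_finite.toFinset with hE
  have hEM : (E : Set α) = M.E := M.ground_finite.coe_toFinset
  obtain ⟨a, ha, haτ, hastr⟩ := exists_modular (E := E) hτ.carriers (fun H hH => by
    obtain ⟨K, -, rfl⟩ := mem_carriers.1 hH
    rw [hEM]; exact K.2.1.subset_ground) c h0
  rw [hEM, h1] at ha
  have hval : ∀ H : ProperFlat M ∅ M.E, (∑ i ∈ E, a i • alphaVec M ∅ M.E i) H
      = ∑ i ∈ E.filter (· ∈ H.1), a i := by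
    intro H
    rw [Finset.sum_apply, sum_filter]
    refine sum_congr rfl fun i _ => ?_
    by_cases h : i ∈ H.1
    · simp [alphaVec_of_mem h, h]
    · simp [alphaVec_of_notMem h, h]
  have hcoe : ∀ H : ProperFlat M ∅ M.E, (↑(E.filter (· ∈ H.1)) : Set α) = H.1 := by
    intro H
    ext i
    have : i ∈ H.1 → i ∈ E := fun h => mem_coe.1 (hEM ▸ H.2.1.subset_ground h)
    simpa using this
  refine ⟨(fun H => c H.1) - ∑ i ∈ E, a i • alphaVec M ∅ M.E i, ?_, fun H hH => ?_,
    fun hc K hK => ?_⟩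
  · rw [sub_sub_cancel]
    exact modular_mem_W hEM ha
  · rw [Pi.sub_apply, hval, haτ _ (by rw [hcoe]; exact coe_mem_carriers.2 hH), hcoe, sub_self]
  · obtain ⟨hK1, hK2⟩ := mem_link.1 hK
    rw [Pi.sub_apply, hval, sub_pos]
    have := hastr ?_ (E.filter (· ∈ K.1)) ?_ ?_ ?_ ?_
    · rwa [hcoe] at this
    · intro I J hI hJ hIJ hJI
      rw [hEM] at hI hJ
      refine hc.lt I J ?_ ?_ ?_ ?_ hIJ hJI
      · exact (Set.empty_subset I).ssubset_of_ne (by rintro rfl; exact hIJ (Set.empty_subset J))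
      · exact hI.ssubset_of_ne (by rintro rfl; exact hJI hJ)
      · exact (Set.empty_subset J).ssubset_of_ne (by rintro rfl; exact hJI (Set.empty_subset I))
      · exact hJ.ssubset_of_ne (by rintro rfl; exact hIJ hI)
    · rw [← coe_ssubset, hcoe, hEM]; exact K.2.2.2
    · rw [← coe_nonempty, hcoe, Set.nonempty_iff_ne_empty]; exact K.2.2.1.ne'
    · rw [hcoe]; exact fun h => hK1 (coe_mem_carriers.1 h)
    · rw [hcoe]
      intro H hH
      obtain ⟨H, hHτ, rfl⟩ := mem_carriers.1 hH
      exact hK2 H hHτ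

theorem exists_representative_vanishing {τ : Finset (ProperFlat M ∅ M.E)} (hτ : IsFlag τ)
    (t : Vec M ∅ M.E) : ∃ t' : Vec M ∅ M.E, t - t' ∈ W M ∅ M.E ∧ ∀ H ∈ τ, t' H = 0 := by
  classical
  obtain ⟨t', h1, h2, -⟩ := exists_representative hτ
    (fun I => if h : M.IsFlat I ∧ ∅ ⊂ I ∧ I ⊂ M.E then t ⟨I, h⟩ else 0)
    (dif_neg fun h => (ssubset_irrefl _ h.2.1)) (dif_neg fun h => (ssubset_irrefl _ h.2.2))
  refine ⟨t', ?_, h2⟩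
  convert h1 using 2
  ext H
  rw [dif_pos H.2]

end Representatives

/-! ### Intersection rings and the signs of degrees. -/

/-- A commutative ring with generators indexed by the proper flats, satisfying the relations of the
Chow ring of a matroid, with a degree map. -/
structure IntersectionRing (M : Matroid α) (d : ℕ) (R : Type*) [CommRing R] [Algebra ℝ R] where
  /-- The classes of the linear forms. -/
  X : Vec M ∅ M.E →ₗ[ℝ] R
  /-- The degree map. -/
  deg : R →ₗ[ℝ] ℝ
  incomparable : ∀ H K : ProperFlat M ∅ M.E, ¬ H.1 ⊆ K.1 → ¬ K.1 ⊆ H.1 →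
    X (delta H) * X (delta K) = 0
  relation : ∀ w ∈ W M ∅ M.E, X w = 0
  top : ∀ σ : Finset (ProperFlat M ∅ M.E), IsFlag σ → σ.card = d →
    deg (∏ H ∈ σ, X (delta H)) = 1

/-- The vectors representing elements of the ample cone. -/
def IsAmple (M : Matroid α) (u : Vec M ∅ M.E) : Prop :=
  ∃ c : Set α → ℝ, StrictlySubmodular M.E c ∧ u = fun H => c H.1

namespace IntersectionRing

variable {d : ℕ} {R : Type*} [CommRing R] [Algebra ℝ R] (A : IntersectionRing M d R)

/-- The monomial of a set of flats. -/
noncomputable def mon (τ : Finset (ProperFlat M ∅ M.E)) : R := ∏ H ∈ τ, A.X (delta H)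

theorem mon_insert [DecidableEq (ProperFlat M ∅ M.E)] {τ : Finset (ProperFlat M ∅ M.E)}
    {K : ProperFlat M ∅ M.E} (hK : K ∉ τ) : A.mon (insert K τ) = A.mon τ * A.X (delta K) := by
  rw [mon, prod_insert hK, mul_comm]; rfl

theorem X_congr {t t' : Vec M ∅ M.E} (h : t - t' ∈ W M ∅ M.E) : A.X t = A.X t' := by
  rw [← sub_eq_zero, ← map_sub, A.relation _ h]

variable [M.Finite]

theorem mon_mul_delta {τ : Finset (ProperFlat M ∅ M.E)} {K : ProperFlat M ∅ M.E} (hK : K ∉ τ)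
    (hK' : K ∉ link τ) : A.mon τ * A.X (delta K) = 0 := by
  classical
  rw [mem_link] at hK'
  push Not at hK'
  obtain ⟨H, hH, h1, h2⟩ := hK' hK
  rw [mon, ← mul_prod_erase τ _ hH, mul_right_comm, A.incomparable H K h1 h2, zero_mul]

theorem X_eq_sum (t : Vec M ∅ M.E) : A.X t = ∑ K, t K • A.X (delta K) := by
  classical
  conv_lhs => rw [pi_eq_sum_univ' t]
  simp only [map_sum, map_smul]
  rfl

/-- Flats of τ drop out because `t` vanishes there, the other flats outside the link because they
are incomparable with a member of τ. -/
theorem deg_mon_mul_X {τ : Finset (ProperFlat M ∅ M.E)} {t : Vec M ∅ M.E}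
    (ht : ∀ H ∈ τ, t H = 0) (q : R) :
    A.deg (A.mon τ * A.X t * q) = ∑ K ∈ link τ, t K * A.deg (A.mon τ * A.X (delta K) * q) := by
  classical
  rw [A.X_eq_sum t, mul_sum, sum_mul, map_sum]
  symm
  refine sum_subset_zero_on_sdiff (subset_univ _) (fun K hK => ?_) fun K _ => ?_
  · by_cases hKτ : K ∈ τ
    · rw [ht K hKτ, zero_smul, mul_zero, zero_mul, map_zero]
    · rw [mul_smul_comm, A.mon_mul_delta hKτ (mem_sdiff.1 hK).2, smul_zero, zero_mul, map_zero]
  · rw [mul_smul_comm, smul_mul_assoc, map_smul, smul_eq_mul]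

variable [M.Loopless]

/-- Replacing one ample factor by its adapted representative gives a positive combination of the
same kind of degree, over longer flags with fewer ample factors; maximal flags have degree one. -/
theorem deg_pos (hr : rk M M.E = d + 1) {τ : Finset (ProperFlat M ∅ M.E)} (hτ : IsFlag τ)
    (us : List (Vec M ∅ M.E))
    (hus : ∀ u ∈ us, IsAmple M u) (hcard : τ.card + us.length = d) :
    0 < A.deg (A.mon τ * (us.map A.X).prod) := by
  classical
  induction us generalizing τ with
  | nil =>
    rw [List.map_nil, List.prod_nil, mul_one, mon, A.top τ hτ (by simpa using hcard)]
    exact one_pos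
  | cons u us ih =>
    obtain ⟨c, hc, rfl⟩ := hus u List.mem_cons_self
    rw [List.length_cons] at hcard
    obtain ⟨t, ht, htτ, htpos⟩ := exists_representative hτ c hc.empty hc.ground
    rw [List.map_cons, List.prod_cons, ← mul_assoc, A.X_congr ht, A.deg_mon_mul_X htτ]
    refine sum_pos (fun K hK => mul_pos (htpos hc K hK) ?_)
      (hτ.link_nonempty (isFlat_empty M) M.ground_isFlat (ground_ssubset hr)
        (by rw [rk_empty]; omega))
    have hKτ := (mem_link.1 hK).1
    rw [← A.mon_insert hKτ]
    exact ih (hτ.insert hK) (fun v hv => hus v (List.mem_cons_of_mem _ hv))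
      (by rw [card_insert_of_notMem hKτ]; omega)

theorem deg_nonneg (hr : rk M M.E = d + 1) {τ : Finset (ProperFlat M ∅ M.E)} (hτ : IsFlag τ)
    {K L : ProperFlat M ∅ M.E}
    (hK : K ∈ link τ) (hL : L ∈ link τ) (hKL : K ≠ L) (us : List (Vec M ∅ M.E))
    (hus : ∀ u ∈ us, IsAmple M u) (hcard : τ.card + us.length + 2 = d) :
    0 ≤ A.deg (A.mon τ * A.X (delta K) * A.X (delta L) * (us.map A.X).prod) ∧
      (K.1 ⊆ L.1 ∨ L.1 ⊆ K.1 →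
        0 < A.deg (A.mon τ * A.X (delta K) * A.X (delta L) * (us.map A.X).prod)) := by
  classical
  have key : K.1 ⊆ L.1 ∨ L.1 ⊆ K.1 →
      0 < A.deg (A.mon τ * A.X (delta K) * A.X (delta L) * (us.map A.X).prod) := by
    intro h
    have hLi := mem_link_insert hL hKL h
    rw [← A.mon_insert (mem_link.1 hK).1, ← A.mon_insert (mem_link.1 hLi).1]
    refine A.deg_pos hr ((hτ.insert hK).insert hLi) us hus ?_
    rw [card_insert_of_notMem (mem_link.1 hLi).1, card_insert_of_notMem (mem_link.1 hK).1]
    omega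
  refine ⟨?_, key⟩
  by_cases h : K.1 ⊆ L.1 ∨ L.1 ⊆ K.1
  · exact (key h).le
  · push Not at h
    rw [mul_assoc (A.mon τ), A.incomparable K L h.1 h.2, mul_zero, zero_mul, map_zero]

/-- Choose `i ∈ K` outside the smaller members of the flag and `j ∉ K` inside the larger ones. The
relation α_i - α_j vanishes on the flag, is 1 at `K` and is nonnegative at the flats comparable with
`K`. Multiplied by the class of `K`, it writes the self-intersection as minus a sum of nonnegative
degrees. -/
theorem deg_sq_nonpos (hr : rk M M.E = d + 1) {τ : Finset (ProperFlat M ∅ M.E)} (hτ : IsFlag τ)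
    {K : ProperFlat M ∅ M.E}
    (hK : K ∈ link τ) (hcard : τ.card + 2 = d) :
    A.deg (A.mon τ * A.X (delta K) * A.X (delta K)) ≤ 0 := by
  classical
  obtain ⟨hKτ, hKc⟩ := mem_link.1 hK
  obtain ⟨i, hiK, hi⟩ := exists_mem_forall_notMem hτ.carriers
    (Set.nonempty_iff_ne_empty.2 K.2.2.1.ne')
  obtain ⟨j, hjE, hjK, hj⟩ := exists_notMem_forall_mem hτ.carriers (E := M.E) (fun H hH => by
    obtain ⟨L, -, rfl⟩ := mem_carriers.1 hH
    exact L.2.1.subset_ground) K.2.2.2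
  have hiE : i ∈ M.E := K.2.1.subset_ground hiK
  set w : Vec M ∅ M.E := alphaVec M ∅ M.E i - alphaVec M ∅ M.E j with hw
  have hwW : w ∈ W M ∅ M.E :=
    alphaVec_sub_mem ⟨hiE, Set.notMem_empty i⟩ ⟨hjE, Set.notMem_empty j⟩
  have hwτ : ∀ H ∈ τ, w H = 0 := by
    intro H hH
    have hne : H.1 ≠ K.1 := fun h => hKτ (Subtype.ext h ▸ hH)
    rcases hKc H hH with h | h
    · have h1 := hi H.1 (coe_mem_carriers.2 hH) (h.ssubset_of_ne hne)
      have h2 : j ∉ H.1 := fun h' => hjK (h h')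
      simp [hw, alphaVec_of_notMem h1, alphaVec_of_notMem h2]
    · have h1 := hj H.1 (coe_mem_carriers.2 hH) (h.ssubset_of_ne hne.symm)
      simp [hw, alphaVec_of_mem h1, alphaVec_of_mem (h hiK)]
  have hwK : w K = 1 := by
    simp [hw, alphaVec_of_mem hiK, alphaVec_of_notMem hjK]
  have hsum := A.deg_mon_mul_X hwτ (A.X (delta K))
  rw [A.relation w hwW, mul_zero, zero_mul, map_zero, ← add_sum_erase _ _ hK, hwK, one_mul] at hsum
  have hnn : 0 ≤ ∑ L ∈ (link τ).erase K,
      w L * A.deg (A.mon τ * A.X (delta L) * A.X (delta K)) := by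
    refine sum_nonneg fun L hL => ?_
    obtain ⟨hne, hL⟩ := mem_erase.1 hL
    have h0 := (A.deg_nonneg hr hτ hL hK hne [] (by simp) (by simpa using hcard)).1
    rw [List.map_nil, List.prod_nil, mul_one] at h0
    by_cases h1 : L.1 ⊆ K.1
    · refine mul_nonneg ?_ h0
      have h2 : j ∉ L.1 := fun h' => hjK (h1 h')
      by_cases h3 : i ∈ L.1
      · simp [hw, alphaVec_of_notMem h2, alphaVec_of_mem h3]
      · simp [hw, alphaVec_of_notMem h2, alphaVec_of_notMem h3]
    by_cases h2 : K.1 ⊆ L.1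
    · refine mul_nonneg ?_ h0
      by_cases h3 : j ∈ L.1
      · simp [hw, alphaVec_of_mem (h2 hiK), alphaVec_of_mem h3]
      · simp [hw, alphaVec_of_mem (h2 hiK), alphaVec_of_notMem h3]
    · rw [mul_assoc, A.incomparable L K h1 h2, mul_zero, map_zero, mul_zero]
  linarith

end IntersectionRing

end MatroidVolume

/-! ### The base case: flags lacking two flats. -/

namespace MatroidVolume
open Matroid Finset

variable {α : Type*} {M : Matroid α}

namespace IntersectionRing

variable {d : ℕ} {R : Type*} [CommRing R] [Algebra ℝ R] (A : IntersectionRing M d R)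

/-- The form `(x, y) ↦ deg (q x y)`. -/
noncomputable def form (q : R) : Vec M ∅ M.E →ₗ[ℝ] Vec M ∅ M.E →ₗ[ℝ] ℝ :=
  LinearMap.mk₂ ℝ (fun x y => A.deg (q * A.X x * A.X y))
    (fun x x' y => by rw [map_add, mul_add, add_mul, map_add])
    (fun c x y => by rw [map_smul, mul_smul_comm, smul_mul_assoc, map_smul])
    (fun x y y' => by rw [map_add, mul_add, map_add])
    (fun c x y => by rw [map_smul, mul_smul_comm, map_smul])

theorem form_apply (q : R) (x y : Vec M ∅ M.E) : A.form q x y = A.deg (q * A.X x * A.X y) := rfl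

theorem form_comm (q : R) (x y : Vec M ∅ M.E) : A.form q x y = A.form q y x := by
  rw [form_apply, form_apply, mul_right_comm]

variable [M.Finite]

/-- It suffices to bound the form on the vectors that vanish on the flag. -/
theorem cauchySchwarz_of_vanishing {τ : Finset (ProperFlat M ∅ M.E)} (hτ : IsFlag τ) (q : R)
    (h : ∃ φ : Vec M ∅ M.E →ₗ[ℝ] ℝ, ∀ t : Vec M ∅ M.E, (∀ H ∈ τ, t H = 0) → φ t = 0 →
      A.form q t t ≤ 0) (v x : Vec M ∅ M.E) (hv : 0 < A.form q v v) :
    A.form q v v * A.form q x x ≤ A.form q v x ^ 2 := by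
  obtain ⟨v', hv1, hv2⟩ := exists_representative_vanishing hτ v
  obtain ⟨x', hx1, hx2⟩ := exists_representative_vanishing hτ x
  obtain ⟨φ, hφ⟩ := h
  have key : A.form q v' v' * A.form q x' x' ≤ A.form q v' x' ^ 2 := by
    let N : Submodule ℝ (Vec M ∅ M.E) :=
      { carrier := {t | ∀ H ∈ τ, t H = 0}
        add_mem' := fun {a b} ha hb H hH => by rw [Pi.add_apply, ha H hH, hb H hH, add_zero]
        zero_mem' := fun _ _ => rfl
        smul_mem' := fun c a ha H hH => by rw [Pi.smul_apply, ha H hH, smul_zero] }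
    refine reverse_cauchySchwarz N (A.form q) (A.form_comm q) ⟨φ, fun t ht => hφ t ht⟩ hv2 hx2 ?_
    simpa only [form_apply, A.X_congr hv1] using hv
  simpa only [form_apply, A.X_congr hv1, A.X_congr hx1] using key

variable [M.Loopless]

/-- The form of a flag of codimension two. -/
theorem cauchySchwarz_codim_two (hr : rk M M.E = d + 1) {τ : Finset (ProperFlat M ∅ M.E)}
    (hτ : IsFlag τ) (hcard : τ.card + 2 = d) (v x : Vec M ∅ M.E)
    (hv : 0 < A.form (A.mon τ) v v) :
    A.form (A.mon τ) v v * A.form (A.mon τ) x x ≤ A.form (A.mon τ) v x ^ 2 := by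
  classical
  have hE := ground_ssubset hr
  obtain ⟨F, G, hF, hG, -, hFG, hGE, hrk, hsplit, hFτ, hGτ⟩ :=
    hτ.exists_gap (isFlat_empty M) M.ground_isFlat hE (by rw [rk_empty]; omega)
  set Pt : Finset (ProperFlat M ∅ M.E) :=
    univ.filter fun p => F ⊂ p.1 ∧ p.1 ⊂ G ∧ rk M p.1 = rk M F + 1 with hPt
  have hex : ∀ p : ProperFlat M ∅ M.E, ∃ i, p ∈ Pt → i ∈ p.1 ∧ i ∉ F := by
    intro p
    by_cases hp : p ∈ Pt
    · obtain ⟨i, hi, hiF⟩ := Set.exists_of_ssubset (mem_filter.1 hp).2.1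
      exact ⟨i, fun _ => ⟨hi, hiF⟩⟩
    · obtain ⟨i, -, -⟩ := Set.exists_of_ssubset hE
      exact ⟨i, fun h => absurd h hp⟩
  choose i hi using hex
  refine A.cauchySchwarz_of_vanishing hτ _ ⟨∑ p ∈ Pt, LinearMap.proj p, fun t ht hφ => ?_⟩ v x hv
  have hφ : ∑ p ∈ Pt, t p = 0 := by simpa using hφ
  obtain ⟨i₀, hi₀, -⟩ := Set.exists_of_ssubset hE
  -- Since `i p` lies in `p` but not in `F`, the vector α of `i p` is 1 at `p`, 0 at the other flats
  -- of `Pt` and 0 on the flag below the gap. Subtracting `s` thus clears `Pt`; above the gap `s`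
  -- equals `∑ t p = 0`, so `t'` still vanishes on the flag.
  set s : Vec M ∅ M.E := ∑ p ∈ Pt, t p • alphaVec M ∅ M.E (i p) with hs
  have hsW : s ∈ W M ∅ M.E := by
    have : s = ∑ p ∈ Pt, t p • (alphaVec M ∅ M.E (i p) - alphaVec M ∅ M.E i₀) := by
      simp only [smul_sub, sum_sub_distrib]
      rw [← sum_smul, hφ, zero_smul, sub_zero]
    rw [this]
    exact Submodule.sum_mem _ fun p hp => Submodule.smul_mem _ _ (alphaVec_sub_mem
      ⟨p.2.1.subset_ground (hi p hp).1, Set.notMem_empty _⟩ ⟨hi₀, Set.notMem_empty _⟩)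
  have hsapp : ∀ H, s H = ∑ p ∈ Pt, t p * alphaVec M ∅ M.E (i p) H := by
    intro H
    rw [hs, Finset.sum_apply]
    rfl
  set t' := t - s with ht'
  have ht'τ : ∀ H ∈ τ, t' H = 0 := by
    intro H hH
    rw [ht', Pi.sub_apply, ht H hH, zero_sub, neg_eq_zero, hsapp]
    rcases hsplit H hH with h | h
    · exact sum_eq_zero fun p hp => by
        rw [alphaVec_of_notMem (fun h' => (hi p hp).2 (h h')), mul_zero]
    · rw [← hφ]
      exact sum_congr rfl fun p hp => by
        rw [alphaVec_of_mem (h ((mem_filter.1 hp).2.2.1.subset (hi p hp).1)), mul_one]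
  have ht'P : ∀ p ∈ Pt, t' p = 0 := by
    intro p hp
    rw [ht', Pi.sub_apply, hsapp, sub_eq_zero, sum_eq_single p]
    · rw [alphaVec_of_mem (hi p hp).1, mul_one]
    · intro q hq hqp
      rw [alphaVec_of_notMem, mul_zero]
      intro hmem
      obtain ⟨hFp, -, hrp⟩ := (mem_filter.1 hp).2
      obtain ⟨hFq, -, hrq⟩ := (mem_filter.1 hq).2
      obtain ⟨z, hz, -, -, hzq, hrz, hmin⟩ := exists_cover hF q.2.1 hFq.subset (hi q hq).1 (hi q hq).2
      have h1 := eq_of_rk_le hz q.2.1 hzq (by omega)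
      have h2 := eq_of_rk_le hz p.2.1 (hmin p.1 p.2.1 hFp.subset hmem) (by omega)
      exact hqp (Subtype.ext (h1.symm.trans h2))
    · exact fun h => absurd hp h
  -- Two comparable flats of the link complete τ to a maximal flag, whose ranks are 1, ..., d. Its
  -- flat of rank `rk M F + 1` cannot come from τ, so one of the two flats lies in `Pt`.
  have hinc : ∀ K ∈ link τ, ∀ L ∈ link τ, K ∉ Pt → L ∉ Pt → K ≠ L →
      A.X (delta K) * A.X (delta L) = 0 := by
    intro K hK L hL hKP hLP hKL
    by_contra hne
    have hcomp : K.1 ⊆ L.1 ∨ L.1 ⊆ K.1 := by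
      by_contra h
      push Not at h
      exact hne (A.incomparable K L h.1 h.2)
    have hLi := mem_link_insert hL hKL hcomp
    have hfl := (hτ.insert hK).insert hLi
    set σ := insert L (insert K τ) with hσ
    have hσc : σ.card = d := by
      rw [card_insert_of_notMem (mem_link.1 hLi).1, card_insert_of_notMem (mem_link.1 hK).1, hcard]
    have himg : σ.image (fun H => rk M H.1) = Ioo 0 (d + 1) := by
      refine eq_of_subset_of_card_le (fun n hn => ?_) ?_
      · obtain ⟨H, -, rfl⟩ := mem_image.1 hn
        have h1 := rk_lt_rk (isFlat_empty M) H.2.1 H.2.2.1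
        have h2 := rk_lt_rk H.2.1 M.ground_isFlat H.2.2.2
        rw [rk_empty] at h1
        exact mem_Ioo.2 ⟨h1, hr ▸ h2⟩
      · rw [card_image_of_injOn, hσc, Nat.card_Ioo]
        · omega
        · intro H hH H' hH' hrr
          rcases hfl H hH H' hH' with h | h
          · exact Subtype.ext (eq_of_rk_le H.2.1 H'.2.1 h hrr.ge)
          · exact Subtype.ext (eq_of_rk_le H'.2.1 H.2.1 h hrr.le).symm
    have hmem : rk M F + 1 ∈ σ.image (fun H => rk M H.1) := by
      have := rk_mono (M := M) hGE
      rw [himg, mem_Ioo]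
      omega
    obtain ⟨H, hH, hrH⟩ := mem_image.1 hmem
    have hlk : ∀ H ∈ link τ, rk M H.1 = rk M F + 1 → H ∈ Pt := by
      intro H hH hrH
      have hc := (mem_link.1 hH).2
      have h1 : F ⊆ H.1 := by
        rcases hFτ with rfl | ⟨H', hH', rfl⟩
        · exact Set.empty_subset _
        · refine (hc H' hH').resolve_right fun h => ?_
          have := rk_mono (M := M) h
          omega
      have h2 : H.1 ⊆ G := by
        rcases hGτ with rfl | ⟨H', hH', rfl⟩
        · exact H.2.1.subset_ground
        · refine (hc H' hH').resolve_left fun h => ?_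
          have := rk_mono (M := M) h
          omega
      refine mem_filter.2 ⟨mem_univ _, h1.ssubset_of_ne ?_, h2.ssubset_of_ne ?_, hrH⟩
      · intro h; rw [← h] at hrH; omega
      · intro h; rw [h] at hrH; omega
    rcases mem_insert.1 hH with rfl | hH
    · exact hLP (hlk _ hL hrH)
    rcases mem_insert.1 hH with rfl | hH
    · exact hKP (hlk _ hK hrH)
    rcases hsplit H hH with h | h
    · have := rk_mono (M := M) h
      omega
    · have := rk_mono (M := M) h
      omega
  have hX : A.X t = A.X t' := A.X_congr (by rw [ht', sub_sub_cancel]; exact hsW)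
  rw [form_apply, hX, A.deg_mon_mul_X ht'τ]
  -- Outside `Pt` the form is diagonal, with nonpositive entries by `deg_sq_nonpos`.
  refine sum_nonpos fun K hK => ?_
  by_cases hKP : K ∈ Pt
  · rw [ht'P K hKP, zero_mul]
  rw [mul_right_comm, A.deg_mon_mul_X ht'τ, sum_eq_single K]
  · have := mul_nonpos_of_nonneg_of_nonpos (mul_self_nonneg (t' K)) (A.deg_sq_nonpos hr hτ hK hcard)
    linarith
  · intro L hL hLK
    by_cases hLP : L ∈ Pt
    · rw [ht'P L hLP, zero_mul]
    · rw [mul_assoc, hinc L hL K hK hLP hKP hLK, mul_zero, map_zero, mul_zero]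
  · exact fun h => absurd hK h

end IntersectionRing

end MatroidVolume

/-! ### The Bochner step and the induction on ample factors. -/

namespace MatroidVolume
open Matroid Finset

variable {α : Type*} {M : Matroid α}

namespace IntersectionRing

variable {d : ℕ} {R : Type*} [CommRing R] [Algebra ℝ R] (A : IntersectionRing M d R)
variable [M.Finite] [M.Loopless]

/-- The inductive step for the Hodge-Riemann inequality. -/
theorem cauchySchwarz_cons (hr : rk M M.E = d + 1) {τ : Finset (ProperFlat M ∅ M.E)}
    (hτ : IsFlag τ) (u : Vec M ∅ M.E) (hu : IsAmple M u) (us : List (Vec M ∅ M.E))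
    (hus : ∀ u ∈ us, IsAmple M u) (hcard : τ.card + us.length + 3 = d)
    (ih : ∀ K ∈ link τ, ∀ v x : Vec M ∅ M.E,
      0 < A.form (A.mon τ * A.X (delta K) * (us.map A.X).prod) v v →
      A.form (A.mon τ * A.X (delta K) * (us.map A.X).prod) v v *
          A.form (A.mon τ * A.X (delta K) * (us.map A.X).prod) x x
        ≤ A.form (A.mon τ * A.X (delta K) * (us.map A.X).prod) v x ^ 2)
    (v x : Vec M ∅ M.E) (hv : 0 < A.form (A.mon τ * ((u :: us).map A.X).prod) v v) :
    A.form (A.mon τ * ((u :: us).map A.X).prod) v v *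
        A.form (A.mon τ * ((u :: us).map A.X).prod) x x
      ≤ A.form (A.mon τ * ((u :: us).map A.X).prod) v x ^ 2 := by
  classical
  set Q := (us.map A.X).prod with hQ
  have hcons : ((u :: us).map A.X).prod = A.X u * Q := by rw [List.map_cons, List.prod_cons]
  rw [hcons] at hv ⊢
  obtain ⟨c, hc, huc⟩ := id hu
  obtain ⟨y, hy, hyτ, hypos⟩ := exists_representative hτ c hc.empty hc.ground
  rw [← huc] at hy
  have hXy : A.X u = A.X y := A.X_congr hy
  -- `B` is the matrix of the form in the coordinates of the link, and `s` is `B` applied to `y`;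
  -- also `s K` is the form of the flag enlarged by `K`, at `(u, u)`.
  let B : ProperFlat M ∅ M.E → ProperFlat M ∅ M.E → ℝ := fun K L =>
    A.deg (A.mon τ * A.X (delta K) * A.X (delta L) * (A.X u * Q))
  let s : ProperFlat M ∅ M.E → ℝ := fun K =>
    A.deg (A.mon τ * A.X (delta K) * (A.X u * (A.X u * Q)))
  have hspos : ∀ K ∈ link τ, 0 < s K := by
    intro K hK
    have hKτ := (mem_link.1 hK).1
    have := A.deg_pos hr (hτ.insert hK) (u :: u :: us)
      (by simpa using ⟨hu, hus⟩) (by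
        rw [card_insert_of_notMem hKτ, List.length_cons, List.length_cons]; omega)
    rwa [A.mon_insert hKτ, List.map_cons, List.prod_cons, hcons] at this
  have hexp : ∀ (t : Vec M ∅ M.E), (∀ H ∈ τ, t H = 0) → ∀ K,
      A.deg (A.mon τ * A.X (delta K) * A.X t * (A.X u * Q)) = ∑ L : link τ, B K L * t L := by
    intro t ht K
    have := A.deg_mon_mul_X ht (A.X (delta K) * (A.X u * Q))
    rw [sum_coe_sort (link τ) fun L => B K L * t L]
    calc _ = A.deg (A.mon τ * A.X t * (A.X (delta K) * (A.X u * Q))) := by congr 1; ring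
      _ = _ := this
      _ = _ := sum_congr rfl fun L _ => by
          rw [mul_comm]
          congr 2
          ring
  have htrickle := trickle_down (ι := link τ) (fun K L => B K L)
    (fun K L => by simp only [B]; congr 1; ring)
    (fun K L hKL => (A.deg_nonneg hr hτ K.2 L.2 (fun h => hKL (Subtype.ext h)) (u :: us)
      (by simpa using ⟨hu, hus⟩) (by rw [List.length_cons]; omega)).1.trans_eq (by rw [hcons]))
    (fun z hz K L => by
      have := hτ.link_connected (isFlat_empty M) M.ground_isFlat (ground_ssubset hr)
        (by rw [rk_empty]; omega) (f := fun K => if h : K ∈ link τ then z ⟨K, h⟩ else 0)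
        (fun K hK L hL hKL => by
          rw [dif_pos hK, dif_pos hL]
          by_cases hne : K = L
          · subst hne; rfl
          refine hz ⟨K, hK⟩ ⟨L, hL⟩ (fun h => hne (congrArg Subtype.val h)) ?_
          have := (A.deg_nonneg hr hτ hK hL hne (u :: us)
            (by simpa using ⟨hu, hus⟩) (by rw [List.length_cons]; omega)).2 (Or.inl hKL)
          rwa [hcons] at this) K.2 L.2
      simpa using this)
    (fun K => y K) (fun K => s K) (fun K => hypos hc K K.2) (fun K => hspos K K.2)
    (fun K => by
      rw [← hexp y hyτ K, ← hXy]
      simp only [s]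
      congr 1
      ring)
  have hexp2 : ∀ (t : Vec M ∅ M.E), (∀ H ∈ τ, t H = 0) →
      A.form (A.mon τ * (A.X u * Q)) t t = ∑ K : link τ, ∑ L : link τ, B K L * t K * t L := by
    intro t ht
    have := A.deg_mon_mul_X ht (A.X t * (A.X u * Q))
    have e : A.form (A.mon τ * (A.X u * Q)) t t
        = A.deg (A.mon τ * A.X t * (A.X t * (A.X u * Q))) := by
      rw [form_apply]; congr 1; ring
    rw [e, this, ← sum_coe_sort (link τ)]
    refine sum_congr rfl fun K _ => ?_
    rw [← mul_assoc (A.mon τ * _), hexp t ht K, mul_sum]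
    exact sum_congr rfl fun L _ => by ring
  -- The Bochner inequality: expanding the factor `u` through `y` splits the form into those of the
  -- enlarged flags, and the induction hypothesis for the pair `(u, t)` bounds each of them by a
  -- square over `s K`.
  have hB := htrickle fun z => by
    set t : Vec M ∅ M.E := fun K => if h : K ∈ link τ then z ⟨K, h⟩ else 0 with ht
    have htτ : ∀ H ∈ τ, t H = 0 := fun H hH => dif_neg fun h => (mem_link.1 h).1 hH
    have htz : ∀ K : link τ, t K = z K := fun K => dif_pos K.2
    have h1 := hexp2 t htτ
    have h2 : ∀ K : link τ, ∑ L : link τ, B K L * z L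
        = A.form (A.mon τ * A.X (delta K.1) * Q) u t := by
      intro K
      rw [form_apply]
      have := hexp t htτ K
      simp only [htz] at this
      rw [← this]
      congr 1
      ring
    simp only [htz] at h1
    rw [← h1]
    have h3 : A.form (A.mon τ * (A.X u * Q)) t t
        = ∑ K : link τ, y K * A.form (A.mon τ * A.X (delta K.1) * Q) t t := by
      have := A.deg_mon_mul_X hyτ (A.X t * A.X t * Q)
      rw [← sum_coe_sort (link τ)] at this
      calc _ = A.deg (A.mon τ * A.X y * (A.X t * A.X t * Q)) := by
            rw [form_apply, hXy]; congr 1; ring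
        _ = _ := this
        _ = _ := sum_congr rfl fun K _ => by
            rw [form_apply]
            congr 2
            ring
    rw [h3]
    refine sum_le_sum fun K _ => ?_
    have hs : A.form (A.mon τ * A.X (delta K.1) * Q) u u = s K := by
      rw [form_apply]
      simp only [s]
      congr 1
      ring
    have hi := ih K.1 K.2 u t (by rw [hs]; exact hspos K.1 K.2)
    rw [hs] at hi
    rw [h2, mul_div_assoc]
    refine mul_le_mul_of_nonneg_left ?_ (hypos hc K.1 K.2).le
    rw [le_div_iff₀ (hspos K.1 K.2)]
    linarith
  -- On vectors vanishing on the flag, the form against `u` is `∑ s K * t K`, so its kernel is the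
  -- hyperplane of `trickle_down`.
  refine A.cauchySchwarz_of_vanishing hτ _ ⟨A.form (A.mon τ * (A.X u * Q)) u, fun t ht hφ => ?_⟩
    v x hv
  rw [hexp2 t ht]
  refine hB (fun K => t K) ?_
  rw [form_apply] at hφ
  have := A.deg_mon_mul_X ht (A.X u * (A.X u * Q))
  rw [← sum_coe_sort (link τ)] at this
  calc _ = ∑ K : link τ, t K * A.deg (A.mon τ * A.X (delta K.1) * (A.X u * (A.X u * Q))) :=
        sum_congr rfl fun K _ => mul_comm _ _
    _ = _ := this.symm
    _ = _ := by rw [← hφ]; congr 1; ring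

/-- The mixed Hodge-Riemann inequality in degree one. -/
theorem cauchySchwarz (hr : rk M M.E = d + 1) (us : List (Vec M ∅ M.E))
    (hus : ∀ u ∈ us, IsAmple M u) {τ : Finset (ProperFlat M ∅ M.E)} (hτ : IsFlag τ)
    (hcard : τ.card + us.length + 2 = d) (v x : Vec M ∅ M.E)
    (hv : 0 < A.form (A.mon τ * (us.map A.X).prod) v v) :
    A.form (A.mon τ * (us.map A.X).prod) v v * A.form (A.mon τ * (us.map A.X).prod) x x
      ≤ A.form (A.mon τ * (us.map A.X).prod) v x ^ 2 := by
  classical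
  induction us generalizing τ v x with
  | nil =>
    simp only [List.map_nil, List.prod_nil, mul_one] at hv ⊢
    exact A.cauchySchwarz_codim_two hr hτ (by simpa using hcard) v x hv
  | cons u us ih =>
    rw [List.length_cons] at hcard
    have hus' : ∀ u ∈ us, IsAmple M u := fun w hw => hus w (List.mem_cons_of_mem _ hw)
    refine A.cauchySchwarz_cons hr hτ u (hus u List.mem_cons_self) us hus' (by omega)
      (fun K hK v x h => ?_) v x hv
    have hKτ := (mem_link.1 hK).1
    rw [← A.mon_insert hKτ] at h ⊢
    exact ih hus' (hτ.insert hK) (by rw [card_insert_of_notMem hKτ]; omega) v x h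

end IntersectionRing

end MatroidVolume

/-! ### The apolar ring of the volume polynomial. -/

namespace MatroidVolume
open Matroid MvPolynomial

variable {α : Type*} {M : Matroid α} {F G : Set α}

section DifferentialOperators

variable {S : Type*}

variable (S) in
/-- The algebra of differential operators with constant coefficients. -/
noncomputable abbrev DiffOp : Subalgebra ℝ (Module.End ℝ (MvPolynomial S ℝ)) :=
  Algebra.adjoin ℝ (Set.range ddₗ)

noncomputable instance commRingDiffOp : CommRing (DiffOp S) :=
  have : IsMulCommutative (DiffOp S) := Algebra.isMulCommutative_adjoin ℝ (by
    rintro _ ⟨x, rfl⟩ _ ⟨y, rfl⟩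
    exact LinearMap.ext fun P => dd_comm x y P)
  open scoped IsMulCommutative in inferInstance

/-- The operators that annihilate a polynomial. -/
def annihilating (P : MvPolynomial S ℝ) : Ideal (DiffOp S) where
  carrier := {a | a.1 P = 0}
  add_mem' {a b} ha hb := by
    change (a.1 + b.1) P = 0
    rw [LinearMap.add_apply, show a.1 P = 0 from ha, show b.1 P = 0 from hb, add_zero]
  zero_mem' := rfl
  smul_mem' c a ha := by
    change (c.1 * a.1) P = 0
    rw [Module.End.mul_apply, show a.1 P = 0 from ha, map_zero]

/-- Constant coefficient operators modulo those annihilating a polynomial. -/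
abbrev ApolarRing (P : MvPolynomial S ℝ) : Type _ := DiffOp S ⧸ annihilating P

variable (S) in
/-- The first order operators. -/
noncomputable def firstOrder : (S → ℝ) →ₗ[ℝ] DiffOp S where
  toFun x := ⟨ddₗ x, Algebra.subset_adjoin ⟨x, rfl⟩⟩
  map_add' _ _ := Subtype.ext (map_add _ _ _)
  map_smul' _ _ := Subtype.ext (map_smul _ _ _)

/-- The class of a first order operator. -/
noncomputable def apolarX (P : MvPolynomial S ℝ) : (S → ℝ) →ₗ[ℝ] ApolarRing P :=
  (Ideal.Quotient.mkₐ ℝ (annihilating P)).toLinearMap ∘ₗ firstOrder S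

/-- Apply an operator to `P` and evaluate at `p`. -/
noncomputable def apolarDeg (P : MvPolynomial S ℝ) (p : S → ℝ) : ApolarRing P →ₗ[ℝ] ℝ :=
  (((annihilating P).restrictScalars ℝ).liftQ
      ((aeval p).toLinearMap ∘ₗ LinearMap.applyₗ P ∘ₗ (DiffOp S).val.toLinearMap)
      (fun a ha => by
        have ha : a.1 P = 0 := ha
        simp [ha])) ∘ₗ
    (Submodule.Quotient.restrictScalarsEquiv ℝ (annihilating P)).symm.toLinearMap

theorem apolarDeg_mk (P : MvPolynomial S ℝ) (p : S → ℝ) (a : DiffOp S) :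
    apolarDeg P p (Ideal.Quotient.mk _ a) = eval p (a.1 P) := rfl

theorem apolarX_eq_mk (P : MvPolynomial S ℝ) (x : S → ℝ) :
    apolarX P x = Ideal.Quotient.mk _ (firstOrder S x) := rfl

theorem coe_prod_firstOrder (l : List (S → ℝ)) :
    ((l.map (firstOrder S)).prod : DiffOp S).1 = (l.map fun v => ddₗ v).prod := by
  induction l with
  | nil => rfl
  | cons x l ih =>
    rw [List.map_cons, List.prod_cons, List.map_cons, List.prod_cons, ← ih]
    rfl

theorem apolarDeg_prod (P : MvPolynomial S ℝ) (p : S → ℝ) (l : List (S → ℝ)) :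
    apolarDeg P p (l.map (apolarX P)).prod = eval p ((l.map fun v => ddₗ v).prod P) := by
  have : (l.map (apolarX P)).prod
      = Ideal.Quotient.mk (annihilating P) (l.map (firstOrder S)).prod := by
    rw [map_list_prod, List.map_map]
    rfl
  rw [this, apolarDeg_mk, coe_prod_firstOrder]

end DifferentialOperators

theorem inclUpper_injective (H : ProperFlat M F G) : Function.Injective (inclUpper H) :=
  fun K L h => by simpa [inclUpper, Subtype.ext_iff] using h

/-- The lift at `H` fixes the basis vectors of flats below `H`, so derivatives along them pass
through the substitution. -/
theorem prod_firstOrder_upperHom (H : ProperFlat M F G) (i : α)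
    (σ : Finset (ProperFlat M F H.1)) (Q : MvPolynomial (ProperFlat M F H.1) ℝ) :
    (∏ K ∈ σ, firstOrder (ProperFlat M F G) (delta (inclUpper H K))).1 (upperHom H i Q)
      = upperHom H i ((∏ K ∈ σ, firstOrder (ProperFlat M F H.1) (delta K)).1 Q) := by
  classical
  induction σ using Finset.induction_on with
  | empty => rfl
  | insert K σ hK ih =>
    rw [Finset.prod_insert hK, Finset.prod_insert hK]
    change dd (delta (inclUpper H K)) ((∏ K ∈ σ, firstOrder (ProperFlat M F G)
      (delta (inclUpper H K))).1 (upperHom H i Q)) = upperHom H i (dd (delta K)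
      ((∏ K ∈ σ, firstOrder (ProperFlat M F H.1) (delta K)).1 Q))
    rw [ih, dd_upperHom, upperVec_delta_inclUpper]

/-- The derivative of a volume polynomial along a maximal flag is one. -/
theorem prod_firstOrder_flag [M.Finite] {P : ∀ F G : Set α, MvPolynomial (ProperFlat M F G) ℝ}
    (hP : ∀ F G, M.IsFlat F → M.IsFlat G → F ⊆ G → VolumeAt M P F G) (hF : M.IsFlat F)
    (hG : M.IsFlat G) (hFG : F ⊆ G) {σ : Finset (ProperFlat M F G)} (hσ : IsFlag σ)
    (hcard : σ.card + 1 + rk M F = rk M G) :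
    (∏ H ∈ σ, firstOrder (ProperFlat M F G) (delta H)).1 (P F G) = 1 := by
  classical
  induction hn : σ.card generalizing G with
  | zero =>
    obtain rfl := Finset.card_eq_zero.1 hn
    rw [Finset.prod_empty]
    exact (hP F G hF hG hFG).one (by simp at hcard; omega)
  | succ n ih =>
    obtain ⟨H', hH', hmax⟩ := exists_top (σ := carriers σ)
      (Finset.card_pos.1 (by rw [card_carriers]; omega)) hσ.carriers
    obtain ⟨H, hH, rfl⟩ := mem_carriers.1 hH'
    set σ' : Finset (ProperFlat M F H.1) := Finset.univ.filter fun K => inclUpper H K ∈ σ with hσ'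
    have hmap : σ'.map ⟨inclUpper H, inclUpper_injective H⟩ = σ.erase H := by
      ext K
      simp only [hσ', Finset.mem_map, Finset.mem_filter, Finset.mem_univ, true_and,
        Function.Embedding.coeFn_mk, Finset.mem_erase]
      constructor
      · rintro ⟨K, hK, rfl⟩
        exact ⟨fun h => K.2.2.2.ne (congrArg Subtype.val h), hK⟩
      · rintro ⟨hne, hK⟩
        exact ⟨⟨K.1, K.2.1, K.2.2.1, (hmax K.1 (coe_mem_carriers.2 hK)).ssubset_of_ne
          fun h => hne (Subtype.ext h)⟩, hK, rfl⟩
    have hcard' : σ'.card = n := by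
      rw [← Finset.card_map ⟨inclUpper H, inclUpper_injective H⟩, hmap, Finset.card_erase_of_mem hH,
        hn]
      rfl
    have hflag : IsFlag σ' := fun K hK L hL =>
      hσ _ (Finset.mem_filter.1 hK).2 _ (Finset.mem_filter.1 hL).2
    have h1 := hflag.card_lt hF H.2.1 H.2.2.1
    have h2 := rk_lt_rk H.2.1 hG H.2.2.2
    obtain ⟨i, hi⟩ := exists_mem_sdiff_upper H
    obtain ⟨j, hj⟩ := exists_mem_sdiff_lower H
    -- Differentiate along the largest flat `H` first. The flag is maximal, so `H` has corank one in
    -- `G`, the factor of M_H^G is 1, and the rest is a maximal flag of M_F^H.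
    rw [← Finset.prod_erase_mul _ _ hH]
    change (∏ K ∈ σ.erase H, firstOrder (ProperFlat M F G) (delta K)).1
      (dd (delta H) (P F G)) = 1
    rw [(hP F G hF hG hFG).deriv H i j hi hj,
      (hP H.1 G H.2.1 hG H.2.2.2.subset).one (by omega), map_one, mul_one, ← hmap,
      Finset.prod_map]
    refine (prod_firstOrder_upperHom H i σ' (P F H.1)).trans ?_
    rw [ih H.2.1 H.2.2.1.subset hflag (by omega) hcard', map_one]

/-- The apolar ring of the volume polynomial. -/
noncomputable def volumeRing [M.Finite] [M.Loopless] {d : ℕ} (hr : rk M M.E = d + 1)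
    {P : ∀ F G : Set α, MvPolynomial (ProperFlat M F G) ℝ}
    (hP : ∀ F G, M.IsFlat F → M.IsFlat G → F ⊆ G → VolumeAt M P F G) (p : Vec M ∅ M.E) :
    IntersectionRing M d (ApolarRing (P ∅ M.E)) where
  X := apolarX (P ∅ M.E)
  deg := apolarDeg (P ∅ M.E) p
  incomparable H K h h' := by
    have hv := hP ∅ M.E (isFlat_empty M) M.ground_isFlat (Set.empty_subset _)
    rw [apolarX_eq_mk, apolarX_eq_mk, ← map_mul, Ideal.Quotient.eq_zero_iff_mem]
    change dd (delta H) (dd (delta K) (P ∅ M.E)) = 0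
    exact deriv_eq_zero_of_incomparable (g := fun K => dd (delta K) (P ∅ M.E)) hv.deriv h h'
  relation w hw := by
    rw [apolarX_eq_mk, Ideal.Quotient.eq_zero_iff_mem]
    exact (hP ∅ M.E (isFlat_empty M) M.ground_isFlat (Set.empty_subset _)).invariant w hw
  top σ hσ hcard := by
    simp only [apolarX_eq_mk]
    rw [← map_prod, apolarDeg_mk, prod_firstOrder_flag hP (isFlat_empty M) M.ground_isFlat
      (Set.empty_subset _) hσ (by rw [rk_empty]; omega), map_one]

end MatroidVolume

/-- The functions compared are constant because `volumePoly M` is a polynomial of degree `d`, so the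
point `p` at which they are evaluated is immaterial. -/
theorem corollaryc {α : Type*} (M : Matroid α) [M.Finite] [M.Loopless] (d : ℕ) (hd : 2 ≤ d)
    (hrank : M.eRank = ((d + 1 : ℕ) : ℕ∞))
    (u : Fin (d - 2) → LM M) (hu : ∀ i, u i ∈ ampleCone M) (x y : LM M) (p : LM M)
    (hx : 0 < D x (D x (Ds u (volumePoly M))) p) :
    D x (D x (Ds u (volumePoly M))) p * D y (D y (Ds u (volumePoly M))) p
      ≤ (D x (D y (Ds u (volumePoly M))) p) ^ 2 := by
  obtain ⟨P, hP⟩ := exists_volumeAt M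
  have hr : rk M M.E = d + 1 := by
    rw [← Matroid.eRk_ground, ← coe_rk] at hrank
    exact_mod_cast hrank
  -- Existence makes the `epsilon` choice a genuine volume family, and uniqueness identifies it with
  -- `P`.
  have hV : ∀ t, volumePoly M (proj M ∅ M.E t) = MvPolynomial.eval t (P ∅ M.E) :=
    volume_eq_eval hP (Classical.epsilon_spec (isVolume_of_volumeAt hP)) ∅ M.E (isFlat_empty M)
      M.ground_isFlat (Set.empty_subset _)
  choose c hc huc using hu
  obtain ⟨x, rfl⟩ := proj_surjective M ∅ M.E x
  obtain ⟨y, rfl⟩ := proj_surjective M ∅ M.E y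
  obtain ⟨p, rfl⟩ := proj_surjective M ∅ M.E p
  set v : Fin (d - 2) → Vec M ∅ M.E := fun i H => c i H.1 with hv
  obtain rfl : u = fun i => proj M ∅ M.E (v i) := funext huc
  -- The degree map evaluates at the given `p`, so constancy of the derivatives is not needed.
  set A := volumeRing hr hP p with hA
  have key : ∀ a b : Vec M ∅ M.E,
      D (proj M ∅ M.E a) (D (proj M ∅ M.E b) (Ds (fun i => proj M ∅ M.E (v i)) (volumePoly M)))
          (proj M ∅ M.E p)
        = A.form (A.mon ∅ * ((List.ofFn v).map A.X).prod) a b := by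
    intro a b
    rw [D_comp_eval (D_comp_eval (Ds_comp_eval hV))]
    have h := apolarDeg_prod (P ∅ M.E) p (a :: b :: List.ofFn v)
    rw [A.form_apply, IntersectionRing.mon, Finset.prod_empty, one_mul, mul_assoc, mul_comm,
      mul_assoc]
    simp only [List.map_cons, List.prod_cons] at h
    exact h.symm
  simp only [key] at hx ⊢
  -- The theorem is the case of the empty flag.
  exact A.cauchySchwarz hr (List.ofFn v) (fun w hw => by
    obtain ⟨i, rfl⟩ := (List.mem_ofFn' _ _).1 hw
    exact ⟨c i, hc i, rfl⟩) (fun H hH => absurd hH (Finset.notMem_empty H))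
    (by rw [Finset.card_empty, List.length_ofFn]; omega) x y hx
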